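/- Let $G$ be a simply connected Lie group of dimension $5$ whose Lie algebra $\mathfrak g$ is nilpotent, let $h$ be a left-invariant Riemannian metric on $G$ with Levi-Civita connection $\nabla$, and let $\xi$ be a left-invariant vector field on $G$. Call $\xi$ \emph{Killing} if $\mathcal L_\xi h=0$, and \emph{one-harmonic Killing} if its (local) flow $\varphi_t$ satisfies $\frac{d}{dt}\big|_{t=0}\tau(\varphi_t)=0$, where $\tau(\varphi)=\operatorname{Tr}_h(\nabla d\varphi)$ is the tension field. Let $$\operatorname{Tr}(\mathcal L_\xi\nabla)=\sum_{i=1}^5(\mathcal L_\xi\nabla)(e_i,e_i),\qquad (\mathcal L_\xi\nabla)(Y,Z)=[\xi,\nabla_YZ]-\nabla_{[\xi,Y]}Z-\nabla_Y[\xi,Z],$$ where $(e_i)$ is an orthonormal basis of the tangent space. Then the following are equivalent: (i) $\xi$ is one-harmonic Killing; (ii) $\operatorname{Tr}(\mathcal L_\xi\nabla)=0$; (iii) $\xi$ is Killing; (iv) $\xi$ lies in the center of $\mathfrak g$ (under the identification of $\mathfrak g$ with the left-invariant vector fields on $G$). -/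

import Mathlib

open Bundle Manifold VectorField FiberBundle
open scoped ContDiff Topology

set_option linter.unusedSectionVars false
set_option linter.unusedSimpArgs false

noncomputable section

namespace OneHarmonic

section Riemannian

variable {E : Type*} [NormedAddCommGroup E] [NormedSpace ℝ E]
  {H : Type*} [TopologicalSpace H] {I : ModelWithCorners ℝ E H}
  {M : Type*} [TopologicalSpace M] [ChartedSpace H M]
  [RiemannianBundle (fun x : M ↦ TangentSpace I x)]

/-- The right-hand side of the Koszul formula for `2 ⟨∇_X Y, Z⟩` at `x`. -/
def koszul (Y X Z : Π x : M, TangentSpace I x) (x : M) : ℝ :=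
  mvfderiv I (fun y ↦ inner ℝ (Y y) (Z y)) x (X x)
    + mvfderiv I (fun y ↦ inner ℝ (X y) (Z y)) x (Y x)
    - mvfderiv I (fun y ↦ inner ℝ (X y) (Y y)) x (Z x)
    + inner ℝ (mlieBracket I X Y x) (Z x)
    - inner ℝ (mlieBracket I X Z x) (Y x)
    - inner ℝ (mlieBracket I Y Z x) (X x)

variable [IsManifold I ∞ M]
  [IsContMDiffRiemannianBundle I ∞ E (fun x : M ↦ TangentSpace I x)]

section aux

variable {f : M → ℝ} {X X' Y Z : Π x : M, TangentSpace I x} {x : M}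

theorem mdifferentiableAt_inner (hX : MDiffAt (T% X) x) (hZ : MDiffAt (T% Z) x) :
    MDiffAt (fun y ↦ inner ℝ (X y) (Z y)) x :=
  MDifferentiableAt.inner_bundle (IB := I) (F := E) (E := fun y : M ↦ TangentSpace I y)
    (b := fun y ↦ y) hX hZ

theorem mvfderiv_inner_smul_left (hf : MDiffAt f x)
    (hX : MDiffAt (T% X) x) (hZ : MDiffAt (T% Z) x) (v : TangentSpace I x) :
    mvfderiv I (fun y ↦ inner ℝ ((f • X) y) (Z y)) x v
      = f x * mvfderiv I (fun y ↦ inner ℝ (X y) (Z y)) x v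
        + mvfderiv I f x v * inner ℝ (X x) (Z x) := by
  have h1 := mvfderiv_mul hf (mdifferentiableAt_inner hX hZ)
  have h2 : (fun y ↦ inner ℝ ((f • X) y) (Z y)) = f * fun y ↦ inner ℝ (X y) (Z y) := by
    ext y; simp [inner_smul_left]
  rw [h2, h1]
  simp only [_root_.add_apply, _root_.smul_apply, smul_eq_mul]
  ring

theorem mvfderiv_inner_add_left (hX : MDiffAt (T% X) x) (hX' : MDiffAt (T% X') x)
    (hZ : MDiffAt (T% Z) x) (v : TangentSpace I x) :
    mvfderiv I (fun y ↦ inner ℝ ((X + X') y) (Z y)) x v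
      = mvfderiv I (fun y ↦ inner ℝ (X y) (Z y)) x v
        + mvfderiv I (fun y ↦ inner ℝ (X' y) (Z y)) x v := by
  have h1 := mvfderiv_add (mdifferentiableAt_inner hX hZ) (mdifferentiableAt_inner hX' hZ)
  have h2 : (fun y ↦ inner ℝ ((X + X') y) (Z y))
      = (fun y ↦ inner ℝ (X y) (Z y)) + fun y ↦ inner ℝ (X' y) (Z y) := by
    ext y; simp [inner_add_left]
  rw [h2, h1]
  rfl

theorem mvfderiv_inner_smul_right (hf : MDiffAt f x)
    (hX : MDiffAt (T% X) x) (hZ : MDiffAt (T% Z) x) (v : TangentSpace I x) :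
    mvfderiv I (fun y ↦ inner ℝ (Z y) ((f • X) y)) x v
      = f x * mvfderiv I (fun y ↦ inner ℝ (Z y) (X y)) x v
        + mvfderiv I f x v * inner ℝ (Z x) (X x) := by
  simp only [fun y ↦ real_inner_comm ((f • X) y) (Z y), fun y ↦ real_inner_comm (X y) (Z y)]
  exact mvfderiv_inner_smul_left hf hX hZ v

theorem mvfderiv_inner_add_right (hX : MDiffAt (T% X) x) (hX' : MDiffAt (T% X') x)
    (hZ : MDiffAt (T% Z) x) (v : TangentSpace I x) :
    mvfderiv I (fun y ↦ inner ℝ (Z y) ((X + X') y)) x v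
      = mvfderiv I (fun y ↦ inner ℝ (Z y) (X y)) x v
        + mvfderiv I (fun y ↦ inner ℝ (Z y) (X' y)) x v := by
  simp only [fun y ↦ real_inner_comm ((X + X') y) (Z y), fun y ↦ real_inner_comm (X y) (Z y),
    fun y ↦ real_inner_comm (X' y) (Z y)]
  exact mvfderiv_inner_add_left hX hX' hZ v

end aux

variable [CompleteSpace E]

theorem tensorialAt_koszul_left {Y Z : Π x : M, TangentSpace I x} {x : M}
    (hY : MDiffAt (T% Y) x) (hZ : MDiffAt (T% Z) x) :
    TensorialAt I E (fun X ↦ koszul Y X Z x) x where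
  smul {f X} hf hX := by
    simp only [koszul, mvfderiv_inner_smul_left hf hX hZ, mvfderiv_inner_smul_left hf hX hY,
      mlieBracket_smul_left hf hX, inner_add_left]
    simp only [Pi.smul_apply', map_smul, inner_smul_left, inner_smul_right, smul_eq_mul]
    simp
    ring
  add {X X'} hX hX' := by
    simp only [koszul, mvfderiv_inner_add_left hX hX' hZ, mvfderiv_inner_add_left hX hX' hY,
      mlieBracket_add_left hX hX', inner_add_left]
    simp only [Pi.add_apply, map_add, inner_add_left, inner_add_right]
    ring

theorem tensorialAt_koszul_right {Y X : Π x : M, TangentSpace I x} {x : M}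
    (hY : MDiffAt (T% Y) x) (hX : MDiffAt (T% X) x) :
    TensorialAt I E (fun Z ↦ koszul Y X Z x) x where
  smul {f Z} hf hZ := by
    simp only [koszul, mvfderiv_inner_smul_right hf hZ hX, mvfderiv_inner_smul_right hf hZ hY,
      mlieBracket_smul_right hf hZ, inner_add_left]
    simp only [Pi.smul_apply', map_smul, inner_smul_left, inner_smul_right, smul_eq_mul]
    simp [real_inner_comm (Z x)]
    ring
  add {Z Z'} hZ hZ' := by
    simp only [koszul, mvfderiv_inner_add_right hZ hZ' hX, mvfderiv_inner_add_right hZ hZ' hY,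
      mlieBracket_add_right hZ hZ']
    simp only [Pi.add_apply, map_add, inner_add_left, inner_add_right]
    ring

theorem koszul_add {Y Y' X Z : Π x : M, TangentSpace I x} {x : M}
    (hY : MDiffAt (T% Y) x) (hY' : MDiffAt (T% Y') x)
    (hX : MDiffAt (T% X) x) (hZ : MDiffAt (T% Z) x) :
    koszul (Y + Y') X Z x = koszul Y X Z x + koszul Y' X Z x := by
  simp only [koszul, mvfderiv_inner_add_right hY hY' hX, mvfderiv_inner_add_left hY hY' hZ,
      mlieBracket_add_right hY hY', mlieBracket_add_left hY hY', inner_add_left]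
  simp only [Pi.add_apply, map_add, inner_add_left, inner_add_right]
  ring

theorem koszul_smul {f : M → ℝ} {Y X Z : Π x : M, TangentSpace I x} {x : M}
    (hf : MDiffAt f x) (hY : MDiffAt (T% Y) x)
    (hX : MDiffAt (T% X) x) (hZ : MDiffAt (T% Z) x) :
    koszul (f • Y) X Z x
      = f x * koszul Y X Z x + 2 * (mvfderiv I f x (X x) * inner ℝ (Y x) (Z x)) := by
  simp only [koszul, mvfderiv_inner_smul_right hf hY hX, mvfderiv_inner_smul_left hf hY hZ,
      mlieBracket_smul_right hf hY, mlieBracket_smul_left hf hY, inner_add_left]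
  simp only [Pi.smul_apply', map_smul, inner_smul_left, inner_smul_right, smul_eq_mul]
  simp [real_inner_comm (X x)]
  ring

variable [FiniteDimensional ℝ E]

/-- The bilinear form `(v, w) ↦ 2 ⟨∇_v Y, w⟩` on the tangent space at `x`. -/
def koszulForm (Y : Π x : M, TangentSpace I x) (x : M) (hY : MDiffAt (T% Y) x) :
    TangentSpace I x →L[ℝ] TangentSpace I x →L[ℝ] ℝ :=
  TensorialAt.mkHom₂ (I := I) (F := E) (F' := E) (fun X Z ↦ koszul Y X Z x) x
    (fun _ hZ ↦ tensorialAt_koszul_left hY hZ) (fun _ hX ↦ tensorialAt_koszul_right hY hX)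

theorem koszulForm_apply {Y X Z : Π x : M, TangentSpace I x} {x : M} (hY : MDiffAt (T% Y) x)
    (hX : MDiffAt (T% X) x) (hZ : MDiffAt (T% Z) x) :
    koszulForm Y x hY (X x) (Z x) = koszul Y X Z x :=
  TensorialAt.mkHom₂_apply _ _ hX hZ

open scoped Classical in
/-- `v ↦ ∇_v Y` at the point `x`, defined by the Koszul formula `2 ⟨∇_v Y, w⟩ = …`
(with the value `0` when `Y` is not differentiable at `x`). -/
def leviCivitaAt (Y : Π x : M, TangentSpace I x) (x : M) :
    TangentSpace I x →L[ℝ] TangentSpace I x :=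
  haveI : FiniteDimensional ℝ (TangentSpace I x) := inferInstanceAs (FiniteDimensional ℝ E)
  haveI : CompleteSpace (TangentSpace I x) := FiniteDimensional.complete ℝ _
  if hY : MDiffAt (T% Y) x then
    LinearMap.toContinuousLinearMap
      { toFun := fun v ↦ (2⁻¹ : ℝ) • (InnerProductSpace.toDual ℝ (TangentSpace I x)).symm
          (koszulForm Y x hY v)
        map_add' := by intro v w; simp
        map_smul' := by
          intro c v
          rw [map_smul, map_smulₛₗ, smul_comm]
          rfl }
  else 0

theorem two_mul_inner_leviCivitaAt {Y X Z : Π x : M, TangentSpace I x} {x : M}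
    (hY : MDiffAt (T% Y) x) (hX : MDiffAt (T% X) x) (hZ : MDiffAt (T% Z) x) :
    2 * inner ℝ (leviCivitaAt Y x (X x)) (Z x) = koszul Y X Z x := by
  have : FiniteDimensional ℝ (TangentSpace I x) := inferInstanceAs (FiniteDimensional ℝ E)
  have : CompleteSpace (TangentSpace I x) := FiniteDimensional.complete ℝ _
  rw [← koszulForm_apply hY hX hZ]
  simp [leviCivitaAt, hY, inner_smul_left]

theorem eq_of_inner_eq {x : M} {v w : TangentSpace I x}
    (h : ∀ Z : Π x : M, TangentSpace I x, MDiffAt (T% Z) x → inner ℝ v (Z x) = inner ℝ w (Z x)) :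
    v = w := by
  refine ext_inner_right ℝ fun u ↦ ?_
  simpa using h (extend E u) (mdifferentiableAt_extend ..)

variable (I M) in
/-- The Levi-Civita connection. -/
def leviCivita : CovariantDerivative I E (TangentSpace I : M → Type _) where
  toFun := leviCivitaAt
  isCovariantDerivativeOnUniv :=
    { add := by
        intro Y Y' x hY hY' _
        ext v
        refine eq_of_inner_eq fun Z hZ ↦ ?_
        have hX : MDiffAt (T% (extend E v)) x := mdifferentiableAt_extend ..
        have h1 := two_mul_inner_leviCivitaAt (mdifferentiableAt_add_section hY hY') hX hZ
        rw [koszul_add hY hY' hX hZ, ← two_mul_inner_leviCivitaAt hY hX hZ,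
          ← two_mul_inner_leviCivitaAt hY' hX hZ] at h1
        simp only [extend_apply_self] at h1
        simp only [_root_.add_apply, inner_add_left]
        linarith
      leibniz := by
        intro Y f x hY hf _
        ext v
        refine eq_of_inner_eq fun Z hZ ↦ ?_
        have hX : MDiffAt (T% (extend E v)) x := mdifferentiableAt_extend ..
        have h1 := two_mul_inner_leviCivitaAt (hf.smul_section hY) hX hZ
        rw [koszul_smul hf hY hX hZ, ← two_mul_inner_leviCivitaAt hY hX hZ] at h1
        simp only [extend_apply_self] at h1
        simp [inner_add_left, inner_smul_left]
        linarith }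

theorem two_mul_inner_leviCivita {Y X Z : Π x : M, TangentSpace I x} {x : M}
    (hY : MDiffAt (T% Y) x) (hX : MDiffAt (T% X) x) (hZ : MDiffAt (T% Z) x) :
    2 * inner ℝ (leviCivita I M Y x (X x)) (Z x) = koszul Y X Z x :=
  two_mul_inner_leviCivitaAt hY hX hZ

/-- The Levi-Civita connection is torsion-free. -/
theorem leviCivita_torsion : (leviCivita I M).torsion = 0 := by
  rw [CovariantDerivative.torsion_eq_zero_iff]
  intro X Y x hX hY
  refine eq_of_inner_eq fun Z hZ ↦ ?_
  have h1 := two_mul_inner_leviCivita hY hX hZ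
  have h2 := two_mul_inner_leviCivita hX hY hZ
  rw [inner_sub_left]
  simp only [koszul, fun y ↦ real_inner_comm (X y) (Y y)] at h1 h2
  rw [mlieBracket_swap_apply (V := Y) (W := X), inner_neg_left] at h2
  linarith

/-- The Levi-Civita connection is compatible with the metric. -/
theorem leviCivita_metric {X Y Z : Π x : M, TangentSpace I x} {x : M}
    (hX : MDiffAt (T% X) x) (hY : MDiffAt (T% Y) x) (hZ : MDiffAt (T% Z) x) :
    mvfderiv I (fun y ↦ inner ℝ (Y y) (Z y)) x (X x)
      = inner ℝ (leviCivita I M Y x (X x)) (Z x) + inner ℝ (Y x) (leviCivita I M Z x (X x)) := by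
  have h1 := two_mul_inner_leviCivita hY hX hZ
  have h2 := two_mul_inner_leviCivita hZ hX hY
  rw [real_inner_comm (leviCivita I M Z x (X x)) (Y x)]
  simp only [koszul, fun y ↦ real_inner_comm (Z y) (Y y)] at h1 h2 ⊢
  rw [mlieBracket_swap_apply (V := Z) (W := Y), inner_neg_left] at h2
  linarith

/-! ### Killing vector fields -/

/-- The Lie derivative of the metric,
`(L_ξ g)(Y, Z) = ξ (g(Y, Z)) - g([ξ, Y], Z) - g(Y, [ξ, Z])`, at `x`. -/
def lieDerivMetric (ξ Y Z : Π x : M, TangentSpace I x) (x : M) : ℝ :=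
  mvfderiv I (fun y ↦ inner ℝ (Y y) (Z y)) x (ξ x)
    - inner ℝ (mlieBracket I ξ Y x) (Z x) - inner ℝ (Y x) (mlieBracket I ξ Z x)

/-- `ξ` is a Killing field: `L_ξ g = 0`. -/
def IsKilling (ξ : Π x : M, TangentSpace I x) : Prop :=
  ∀ (x : M) (Y Z : Π x : M, TangentSpace I x), MDiffAt (T% Y) x → MDiffAt (T% Z) x →
    lieDerivMetric ξ Y Z x = 0

/-! ### The trace of the Lie derivative of the Levi-Civita connection -/

/-- The Lie derivative of the Levi-Civita connection,
`(L_ξ ∇)(Y, Z) = [ξ, ∇_Y Z] - ∇_{[ξ, Y]} Z - ∇_Y [ξ, Z]`, at `x`. -/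
def lieDerivConnection (ξ Y Z : Π x : M, TangentSpace I x) (x : M) : TangentSpace I x :=
  mlieBracket I ξ (fun y ↦ leviCivita I M Z y (Y y)) x
    - leviCivita I M Z x (mlieBracket I ξ Y x)
    - leviCivita I M (mlieBracket I ξ Z) x (Y x)

instance (x : M) : FiniteDimensional ℝ (TangentSpace I x) :=
  inferInstanceAs (FiniteDimensional ℝ E)

/-- The metric trace `Tr (L_ξ ∇) = ∑ i, (L_ξ ∇)(e i, e i)` at `x`, for an orthonormal basis `e` of
the tangent space at `x`. As `L_ξ ∇` is a tensor field, its value on tangent vectors at `x` is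
computed with arbitrary smooth vector fields near `x` that extend them. -/
def traceLieDerivConnection (ξ : Π x : M, TangentSpace I x) (x : M) : TangentSpace I x :=
  ∑ i, lieDerivConnection ξ (extend E (stdOrthonormalBasis ℝ (TangentSpace I x) i))
    (extend E (stdOrthonormalBasis ℝ (TangentSpace I x) i)) x

/-! ### Tension fields and one-harmonic Killing fields -/

/-- The second fundamental form `(∇dφ)(v, w)` at `x` of a map `φ : M → M` which is a local
diffeomorphism at `x`: if `W` is a vector field near `φ x` with `W (φ x) = dφ w`, then `W ∘ φ` is
the image under `dφ` of the pullback `φ^* W`, so that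
`(∇dφ)(v, w) = ∇_{dφ v} W - dφ (∇_v (φ^* W))`. -/
def secondFundamentalForm (φ : M → M) (x : M) (v w : TangentSpace I x) : TangentSpace I (φ x) :=
  leviCivita I M (extend E (mfderiv I I φ x w)) (φ x) (mfderiv I I φ x v)
    - mfderiv I I φ x
        (leviCivita I M (mpullback I I φ (extend E (mfderiv I I φ x w))) x v)

/-- The tension field `τ(φ) = Tr ∇dφ` at `x` of a map `φ : M → M` which is a local diffeomorphism
at `x`. -/
def tensionField (φ : M → M) (x : M) : TangentSpace I (φ x) :=
  ∑ i, secondFundamentalForm φ x (stdOrthonormalBasis ℝ (TangentSpace I x) i)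
    (stdOrthonormalBasis ℝ (TangentSpace I x) i)

/-- `Φ t y`, for `|t| < ε` and `y ∈ U`, is the local flow (local one-parameter group of
diffeomorphisms) of the vector field `ξ`. -/
def IsLocalFlow (ξ : Π x : M, TangentSpace I x) (Φ : ℝ → M → M) (U : Set M) (ε : ℝ) : Prop :=
  ∀ y ∈ U, Φ 0 y = y ∧ IsMIntegralCurveOn (fun t ↦ Φ t y) ξ (Set.Ioo (-ε) ε)

/-- `ξ` is a one-harmonic Killing field: its local flow `Φ` satisfies `d/dt τ(Φ t) = 0` at `t = 0`.
The vectors `τ(Φ t)` at `x` lie in the tangent spaces at the points `Φ t x`; they are brought to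
the tangent space at `x` by the inverse of the differential of `Φ t`. As `τ(Φ 0) = τ(id) = 0`, the
vanishing of the derivative at `t = 0` does not depend on this choice; it is the vanishing of the
covariant derivative of `t ↦ τ(Φ t)(x)` along `t ↦ Φ t x` at `t = 0`. -/
def IsOneHarmonicKilling (ξ : Π x : M, TangentSpace I x) : Prop :=
  ∀ x : M, ∃ (Φ : ℝ → M → M) (U : Set M) (ε : ℝ), U ∈ 𝓝 x ∧ 0 < ε ∧ IsLocalFlow ξ Φ U ε ∧
    HasDerivAt (fun t ↦ (mfderiv I I (Φ t) x).inverse (tensionField (I := I) (Φ t) x))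
      (0 : TangentSpace I x) (0 : ℝ)

end Riemannian

section LieGroups

variable {E : Type*} [NormedAddCommGroup E] [NormedSpace ℝ E]
  {H : Type*} [TopologicalSpace H] {I : ModelWithCorners ℝ E H}
  {G : Type*} [TopologicalSpace G] [ChartedSpace H G] [Group G]

instance [LieGroup I ∞ G] : LieGroup I (minSmoothness ℝ 3) G := by
  rw [minSmoothness_of_isRCLikeNormedField]
  infer_instance

/-- Left-invariance of a vector field on a Lie group. -/
def IsLeftInvariant (ξ : Π x : G, TangentSpace I x) : Prop :=
  ∀ g x : G, mfderiv I I (fun y ↦ g * y) x (ξ x) = ξ (g * x)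

variable (I G) in
/-- Left-invariance of a Riemannian metric on a Lie group: left translations are isometries. -/
def IsLeftInvariantMetric [RiemannianBundle (fun x : G ↦ TangentSpace I x)] : Prop :=
  ∀ (g x : G) (v w : TangentSpace I x),
    inner ℝ (mfderiv I I (fun y ↦ g * y) x v) (mfderiv I I (fun y ↦ g * y) x w) = inner ℝ v w

end LieGroups

end OneHarmonic

end

/-!
A left-invariant field on `G` is determined by its value `ξ` at the identity, and every condition in
the theorem is equivalent to `ad ξ = 0`, that is, to `ξ` being central.

*Killing fields.* For left-invariant fields the metric is constant, so `L_ξ h = 0` says that `ad ξ`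
is skew-symmetric (`isKilling_mulInvariantVectorField_iff`). As `ad ξ` is also nilpotent,
`∑ ‖[ξ, eᵢ]‖² = - tr (ad ξ)² = 0`, so that `ad ξ = 0` (`eq_zero_of_isNilpotent_of_skew`).

*The trace of `L_ξ ∇`.* By the Koszul formula `∇` induces a product on the Lie algebra
(`leviCivitaₗ`), and `Tr (L_ξ ∇)` is the left-invariant field of the vector
`T = ∑ ([ξ, ∇_{eᵢ} eᵢ] - ∇_{[ξ, eᵢ]} eᵢ - ∇_{eᵢ} [ξ, eᵢ])` (`traceLieDerivConnection_eq`). For a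
unimodular Lie algebra `⟨T, ξ⟩ = - (∑ ‖[ξ, eᵢ]‖² + tr (ad ξ)²)` (`inner_trace_lieDeriv_self`); by
nilpotency the last term vanishes, hence `T = 0` forces `ad ξ = 0`.

The definition of `Tr (L_ξ ∇)` involves arbitrary smooth extensions of tangent vectors. That
`L_ξ ∇` is a tensor is proved by expanding one argument in a left-invariant frame
(`lieDerivConnection_mulInv_left`); the second derivatives of the coefficients cancel because
`[U, V] f = U (V f) - V (U f)`, which is a consequence of the Jacobi identity for `U`, `V` and `f W`
(`mvfderiv_mvfderiv_sub_smul`).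

*The flow.* The flow of `ξ` consists of the right translations `R_{γ t}`, where `γ` is the integral
curve through the identity (`IsLocalFlow.eventuallyEq_mul_right`, by uniqueness of integral curves).
The differential of `R_a` maps the left-invariant field of `Ad a w` to that of `w`; hence the
tension field of `R_a`, transported back to `x` by the differential, is the left-invariant field of
`∑ (Ad a (∇_{(Ad a)⁻¹ eᵢ} (Ad a)⁻¹ eᵢ) - ∇_{eᵢ} eᵢ)` (`inverse_mfderiv_tensionField`). Since the
derivative of `Ad` along `γ` is `ad ξ` (`hasDerivAt_adjointMap`, by a computation with the second
derivative of the multiplication in a chart), the derivative of this vector at `t = 0` is `T`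
(`hasDerivAt_tensionField`). So `ξ` is one-harmonic Killing if and only if `Tr (L_ξ ∇) = 0`.
-/

noncomputable section

namespace OneHarmonic

/-! ### Skew-symmetric and nilpotent endomorphisms -/

section Algebra

variable {V : Type*} [NormedAddCommGroup V] [InnerProductSpace ℝ V] [FiniteDimensional ℝ V]
  {ι : Type*} [Fintype ι]

theorem trace_eq_sum_inner_self (e : OrthonormalBasis ι ℝ V) (A : V →ₗ[ℝ] V) :
    LinearMap.trace ℝ V A = ∑ i, inner ℝ (A (e i)) (e i) := by
  classical
  rw [LinearMap.trace_eq_sum_inner A e]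
  exact Finset.sum_congr rfl fun i _ ↦ real_inner_comm _ _

theorem eq_zero_of_sum_inner_self_eq_zero (e : OrthonormalBasis ι ℝ V) {A : V →ₗ[ℝ] V}
    (hA : ∑ i, inner ℝ (A (e i)) (A (e i)) = 0) : A = 0 := by
  refine e.toBasis.ext fun i ↦ ?_
  have h := (Finset.sum_eq_zero_iff_of_nonneg fun i _ ↦ real_inner_self_nonneg).1 hA i
    (Finset.mem_univ i)
  simpa using h

/-- A nilpotent skew-symmetric endomorphism vanishes, as `∑ ‖A eᵢ‖² = - tr A² = 0`. -/
theorem eq_zero_of_isNilpotent_of_skew {A : V →ₗ[ℝ] V} (hA : IsNilpotent A)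
    (hskew : ∀ v w, inner ℝ (A v) w + inner ℝ v (A w) = 0) : A = 0 := by
  have e := stdOrthonormalBasis ℝ V
  refine eq_zero_of_sum_inner_self_eq_zero e ?_
  have h1 := trace_eq_sum_inner_self e (A * A)
  have h2 : LinearMap.trace ℝ V (A * A) = 0 :=
    (LinearMap.isNilpotent_trace_of_isNilpotent
      ((Commute.refl A).isNilpotent_mul_right hA)).eq_zero
  rw [h2] at h1
  rw [← neg_eq_zero, ← Finset.sum_neg_distrib, h1]
  refine Finset.sum_congr rfl fun i _ ↦ ?_
  have := hskew (A (e i)) (e i)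
  rw [Module.End.mul_apply]
  linarith

/-- A pointwise form of Yano's formula for a metric Lie algebra: for unimodular brackets,
`⟨Tr (L_ξ ∇), ξ⟩ = - (∑ ‖[ξ, eᵢ]‖² + tr (ad ξ)²)`. -/
theorem inner_trace_lieDeriv_self (B : V →ₗ[ℝ] V →ₗ[ℝ] V) (D : V → V → V)
    (hB : ∀ v w, B v w = - B w v)
    (hD : ∀ v w u, 2 * inner ℝ (D v w) u
      = inner ℝ (B v w) u - inner ℝ (B v u) w - inner ℝ (B w u) v)
    (hB' : ∀ v, LinearMap.trace ℝ V (B v) = 0) (e : OrthonormalBasis ι ℝ V) (ξ : V) :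
    inner ℝ (∑ i, (B ξ (D (e i) (e i)) - D (B ξ (e i)) (e i) - D (e i) (B ξ (e i)))) ξ
      = - (∑ i, inner ℝ (B ξ (e i)) (B ξ (e i)) + LinearMap.trace ℝ V (B ξ * B ξ)) := by
  have h1 : ∑ i, D (e i) (e i) = 0 := by
    refine ext_inner_right ℝ fun u ↦ ?_
    rw [sum_inner, inner_zero_left, ← hB' u, trace_eq_sum_inner_self e]
    refine Finset.sum_congr rfl fun i _ ↦ ?_
    have h := hD (e i) (e i) u
    have h0 := congrArg (fun v ↦ inner ℝ v u) (hB (e i) (e i))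
    simp only [inner_neg_left] at h0
    rw [hB (e i) u, inner_neg_left] at h
    linarith
  have h2 : ∑ i, (B ξ (D (e i) (e i)) - D (B ξ (e i)) (e i) - D (e i) (B ξ (e i)))
      = - ∑ i, (D (B ξ (e i)) (e i) + D (e i) (B ξ (e i))) := by
    simp only [sub_sub, Finset.sum_sub_distrib]
    rw [← map_sum, h1, map_zero, zero_sub]
  rw [h2, inner_neg_left, sum_inner, trace_eq_sum_inner_self e, ← Finset.sum_add_distrib]
  congr 1
  refine Finset.sum_congr rfl fun i _ ↦ ?_
  have h3 := hD (B ξ (e i)) (e i) ξ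
  have h4 := hD (e i) (B ξ (e i)) ξ
  rw [hB (e i) (B ξ (e i)), inner_neg_left] at h4
  rw [hB (B ξ (e i)) ξ, hB (e i) ξ, inner_neg_left, inner_neg_left] at h3 h4
  rw [inner_add_left, Module.End.mul_apply]
  linarith

/-- For a nilpotent bracket, the trace terms in `inner_trace_lieDeriv_self` vanish, so that
`Tr (L_ξ ∇) = 0` forces `ad ξ = 0`. -/
theorem eq_zero_of_trace_lieDeriv_eq_zero (B : V →ₗ[ℝ] V →ₗ[ℝ] V) (D : V → V → V)
    (hB : ∀ v w, B v w = - B w v)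
    (hD : ∀ v w u, 2 * inner ℝ (D v w) u
      = inner ℝ (B v w) u - inner ℝ (B v u) w - inner ℝ (B w u) v)
    (hB' : ∀ v, IsNilpotent (B v)) (e : OrthonormalBasis ι ℝ V) {ξ : V}
    (hξ : ∑ i, (B ξ (D (e i) (e i)) - D (B ξ (e i)) (e i) - D (e i) (B ξ (e i))) = 0) :
    B ξ = 0 := by
  refine eq_zero_of_sum_inner_self_eq_zero e ?_
  have h := inner_trace_lieDeriv_self B D hB hD
    (fun v ↦ (LinearMap.isNilpotent_trace_of_isNilpotent (hB' v)).eq_zero) e ξ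
  rw [hξ, inner_zero_left, (LinearMap.isNilpotent_trace_of_isNilpotent
    ((Commute.refl (B ξ)).isNilpotent_mul_right (hB' ξ))).eq_zero] at h
  linarith

end Algebra

/-! ### Left-invariant vector fields -/

section LeftInvariant

variable {E : Type*} [NormedAddCommGroup E] [NormedSpace ℝ E]
  {H : Type*} [TopologicalSpace H] {I : ModelWithCorners ℝ E H}
  {G : Type*} [TopologicalSpace G] [ChartedSpace H G] [Group G] [LieGroup I ∞ G]

theorem mdifferentiableAt_mul_left (g x : G) : MDiffAt (fun y ↦ g * y) x :=
  (contMDiff_mul_left (I := I) (n := ∞) (a := g)).mdifferentiable (by simp) x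

theorem mdifferentiableAt_mul_right (g x : G) : MDiffAt (fun y ↦ y * g) x :=
  (contMDiff_mul_right (I := I) (n := ∞) (a := g)).mdifferentiable (by simp) x

theorem isLeftInvariant_mulInvariantVectorField (v : TangentSpace I (1 : G)) :
    IsLeftInvariant (mulInvariantVectorField v) := by
  intro g x
  have h : (fun y ↦ g * x * y) = (fun y ↦ g * y) ∘ (fun y ↦ x * y) := by
    ext y; simp [mul_assoc]
  have h2 := mfderiv_comp_of_eq (x := (1 : G)) (y := x) (mdifferentiableAt_mul_left (I := I) g x)
    (mdifferentiableAt_mul_left (I := I) x 1) (mul_one x)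
  have h3 : ∀ y : G, y = x →
      (show E →L[ℝ] E from mfderiv I I (fun z ↦ g * z) y) = mfderiv I I (fun z ↦ g * z) x := by
    rintro _ rfl; rfl
  simp only [mulInvariantVectorField]
  rw [h, h2]
  exact (DFunLike.congr_fun (h3 _ (mul_one x)) _).symm

theorem IsLeftInvariant.eq_mulInvariantVectorField {ξ : Π x : G, TangentSpace I x}
    (hξ : IsLeftInvariant ξ) : ξ = mulInvariantVectorField (ξ 1) := by
  ext g
  have h2 : ∀ y : G, y = g → (show E from ξ y) = ξ g := by rintro _ rfl; rfl
  exact ((hξ g 1).trans (h2 _ (mul_one g))).symm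

theorem mulInvariantVectorField_one (v : TangentSpace I (1 : G)) :
    mulInvariantVectorField v 1 = v := by
  have h : (fun y : G ↦ 1 * y) = id := by ext y; simp
  simp only [mulInvariantVectorField]
  rw [h, mfderiv_id]
  rfl

theorem contMDiff_two_mulInvariantVectorField (v : TangentSpace I (1 : G)) :
    ContMDiff I I.tangent 2
      (fun g : G ↦ (⟨g, mulInvariantVectorField v g⟩ : TangentBundle I G)) :=
  (contMDiff_mulInvariantVectorField (I := I) (G := G) v).of_le le_minSmoothness

theorem eventually_mdifferentiableAt {E' : Type*} [NormedAddCommGroup E'] [NormedSpace ℝ E']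
    {H' : Type*} [TopologicalSpace H'] {J : ModelWithCorners ℝ E' H'} {N : Type*}
    [TopologicalSpace N] [ChartedSpace H' N] [IsManifold J 2 N] {f : G → N} {x : G}
    (hf : ContMDiffAt I J 2 f x) : ∀ᶠ y in 𝓝 x, MDiffAt f y :=
  ((contMDiffAt_iff_contMDiffAt_nhds (by simp)).1 hf).mono
    fun _ h ↦ h.mdifferentiableAt (by simp)

theorem contMDiffAt_one_mlieBracket [CompleteSpace E] {Y Z : Π x : G, TangentSpace I x} {x : G}
    (hY : CMDiffAt 2 (T% Y) x) (hZ : CMDiffAt 2 (T% Z) x) :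
    CMDiffAt 1 (T% (mlieBracket I Y Z)) x :=
  haveI : IsManifold I (((2 : ℕ∞) : ℕ∞ω) + 1) G := IsManifold.of_le (n := ∞) (by norm_cast)
  ContMDiffAt.mlieBracket_vectorField (m := 1) (n := 2) hY hZ
    (by rw [minSmoothness_of_isRCLikeNormedField]; norm_num)

variable [RiemannianBundle (fun x : G ↦ TangentSpace I x)]

theorem IsLeftInvariantMetric.inner_mulInvariantVectorField (hG : IsLeftInvariantMetric I G)
    (v w : TangentSpace I (1 : G)) (x : G) :
    inner ℝ (mulInvariantVectorField v x) (mulInvariantVectorField w x) = inner ℝ v w := by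
  rw [← hG x 1 v w]
  have h2 : ∀ y : G, y = x → ∀ a b : E, inner ℝ (show TangentSpace I x from a) b =
    inner ℝ (show TangentSpace I y from a) b := by rintro _ rfl _ _; rfl
  exact h2 _ (mul_one x) _ _

variable [FiniteDimensional ℝ E]

/-- Left translation to `x`, as a linear isometry from the Lie algebra to the tangent space. -/
def leftTranslate (hG : IsLeftInvariantMetric I G) (x : G) :
    TangentSpace I (1 : G) ≃ₗᵢ[ℝ] TangentSpace I x :=
  LinearIsometry.toLinearIsometryEquiv
    (LinearMap.isometryOfInner
      { toFun := fun v ↦ mulInvariantVectorField v x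
        map_add' := fun v w ↦ by rw [mulInvariantVectorField_add]; rfl
        map_smul' := fun c v ↦ by rw [mulInvariantVectorField_smul]; rfl }
      fun v w ↦ hG.inner_mulInvariantVectorField v w x) rfl

theorem leftTranslate_apply (hG : IsLeftInvariantMetric I G) (x : G)
    (v : TangentSpace I (1 : G)) : leftTranslate hG x v = mulInvariantVectorField v x := rfl

end LeftInvariant

/-! ### Bracket and connection on the Lie algebra -/

section LeftInvariant

variable {E : Type*} [NormedAddCommGroup E] [NormedSpace ℝ E]
  {H : Type*} [TopologicalSpace H] {I : ModelWithCorners ℝ E H}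
  {G : Type*} [TopologicalSpace G] [ChartedSpace H G] [Group G] [LieGroup I ∞ G]
  [CompleteSpace E] [FiniteDimensional ℝ E]

variable (I G) in
/-- The Lie bracket of the Lie algebra of `G`, as a bilinear map on the tangent space at `1`. -/
def lieBracketₗ :
    TangentSpace I (1 : G) →ₗ[ℝ] TangentSpace I (1 : G) →ₗ[ℝ] TangentSpace I (1 : G) :=
  LinearMap.mk₂ ℝ (fun v w ↦ ⁅(v : GroupLieAlgebra I G), (w : GroupLieAlgebra I G)⁆)
    (fun v w u ↦ add_lie (L := GroupLieAlgebra I G) v w u)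
    (fun c v w ↦ smul_lie (L := GroupLieAlgebra I G) c v w)
    (fun v w u ↦ lie_add (L := GroupLieAlgebra I G) v w u)
    (fun c v w ↦ lie_smul (L := GroupLieAlgebra I G) c v w)

theorem lieBracketₗ_skew (v w : TangentSpace I (1 : G)) :
    lieBracketₗ I G v w = - lieBracketₗ I G w v :=
  (lie_skew (L := GroupLieAlgebra I G) v w).symm

theorem mlieBracket_mulInvariantVectorField (v w : TangentSpace I (1 : G)) :
    mlieBracket I (mulInvariantVectorField v) (mulInvariantVectorField w)
      = mulInvariantVectorField (lieBracketₗ I G v w) :=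
  (mulInvariantVector_mlieBracket v w).symm

theorem lieBracketₗ_eq_zero_iff (v : TangentSpace I (1 : G)) :
    lieBracketₗ I G v = 0 ↔ v ∈ LieAlgebra.center ℝ (GroupLieAlgebra I G) := by
  rw [LieModule.mem_maxTrivSubmodule]
  constructor
  · intro h w
    have h1 := lieBracketₗ_skew (I := I) (G := G) w v
    rw [h, LinearMap.zero_apply, neg_zero] at h1
    exact h1
  · intro h
    ext w
    have h1 := lieBracketₗ_skew (I := I) (G := G) v w
    rw [h1, LinearMap.zero_apply, neg_eq_zero]
    exact h w

theorem isNilpotent_lieBracketₗ [LieRing.IsNilpotent (GroupLieAlgebra I G)]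
    (v : TangentSpace I (1 : G)) : IsNilpotent (lieBracketₗ I G v) := by
  obtain ⟨k, hk⟩ := LieModule.exists_forall_pow_toEnd_eq_zero (R := ℝ)
    (GroupLieAlgebra I G) (GroupLieAlgebra I G)
  exact ⟨k, hk v⟩

theorem mdifferentiableAt_mulInv (v : TangentSpace I (1 : G)) (x : G) :
    MDiffAt (T% (mulInvariantVectorField v)) x :=
  mdifferentiableAt_mulInvariantVectorField (I := I) v

variable [RiemannianBundle (fun x : G ↦ TangentSpace I x)]
  [IsContMDiffRiemannianBundle I ∞ E (fun x : G ↦ TangentSpace I x)]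

/-- The derivatives in the Koszul formula vanish for left-invariant fields. -/
theorem koszul_mulInvariantVectorField (hG : IsLeftInvariantMetric I G)
    (v w u : TangentSpace I (1 : G)) (x : G) :
    koszul (I := I) (mulInvariantVectorField w) (mulInvariantVectorField v)
        (mulInvariantVectorField u) x
      = inner ℝ (lieBracketₗ I G v w) u - inner ℝ (lieBracketₗ I G v u) w
        - inner ℝ (lieBracketₗ I G w u) v := by
  simp only [koszul, mlieBracket_mulInvariantVectorField, hG.inner_mulInvariantVectorField,
    mvfderiv_const, _root_.zero_apply]
  ring

variable (I G) in
/-- The Levi-Civita connection of left-invariant vector fields, as a product on the tangent space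
at `1`. -/
def leviCivitaₗ :
    TangentSpace I (1 : G) →ₗ[ℝ] TangentSpace I (1 : G) →ₗ[ℝ] TangentSpace I (1 : G) :=
  LinearMap.mk₂ ℝ (fun v w ↦ leviCivita I G (mulInvariantVectorField w) 1 v)
    (fun v w u ↦ map_add _ _ _)
    (fun c v w ↦ map_smul _ _ _)
    (fun v w u ↦ by
      rw [mulInvariantVectorField_add, (leviCivita I G).isCovariantDerivativeOnUniv.add
        (mdifferentiableAt_mulInv w 1) (mdifferentiableAt_mulInv u 1)]
      rfl)
    (fun c v w ↦ by
      rw [mulInvariantVectorField_smul, (leviCivita I G).isCovariantDerivativeOnUniv.smul_const c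
        (mdifferentiableAt_mulInv w 1)]
      rfl)

theorem two_mul_inner_leviCivitaₗ (hG : IsLeftInvariantMetric I G)
    (v w u : TangentSpace I (1 : G)) :
    2 * inner ℝ (leviCivitaₗ I G v w) u
      = inner ℝ (lieBracketₗ I G v w) u - inner ℝ (lieBracketₗ I G v u) w
        - inner ℝ (lieBracketₗ I G w u) v := by
  have h := two_mul_inner_leviCivita (mdifferentiableAt_mulInv w 1)
    (mdifferentiableAt_mulInv v 1) (mdifferentiableAt_mulInv u 1)
  rw [koszul_mulInvariantVectorField hG] at h
  simp only [mulInvariantVectorField_one] at h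
  exact h

theorem leviCivita_mulInvariantVectorField (hG : IsLeftInvariantMetric I G)
    (v w : TangentSpace I (1 : G)) (x : G) :
    leviCivita I G (mulInvariantVectorField w) x (mulInvariantVectorField v x)
      = mulInvariantVectorField (leviCivitaₗ I G v w) x := by
  refine ext_inner_right ℝ fun u ↦ ?_
  obtain ⟨u, rfl⟩ := (leftTranslate hG x).surjective u
  have h := two_mul_inner_leviCivita (mdifferentiableAt_mulInv w x)
    (mdifferentiableAt_mulInv v x) (mdifferentiableAt_mulInv u x)
  rw [koszul_mulInvariantVectorField hG, ← two_mul_inner_leviCivitaₗ hG] at h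
  rw [leftTranslate_apply, hG.inner_mulInvariantVectorField]
  linarith

end LeftInvariant

/-! ### The Lie derivative of the metric -/

section LeftInvariant

variable {E : Type*} [NormedAddCommGroup E] [NormedSpace ℝ E]
  {H : Type*} [TopologicalSpace H] {I : ModelWithCorners ℝ E H}
  {G : Type*} [TopologicalSpace G] [ChartedSpace H G] [Group G] [LieGroup I ∞ G]
  [CompleteSpace E] [FiniteDimensional ℝ E]
  [RiemannianBundle (fun x : G ↦ TangentSpace I x)]
  [IsContMDiffRiemannianBundle I ∞ E (fun x : G ↦ TangentSpace I x)]

/-- The Lie derivative of the metric is a tensor in its first argument. -/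
theorem tensorialAt_lieDerivMetric_left {ξ Z : Π x : G, TangentSpace I x} {x : G}
    (hZ : MDiffAt (T% Z) x) : TensorialAt I E (fun Y ↦ lieDerivMetric ξ Y Z x) x where
  smul {f Y} hf hY := by
    rw [lieDerivMetric, mvfderiv_inner_smul_left hf hY hZ, mlieBracket_smul_right hf hY,
      inner_add_left, Pi.smul_apply']
    simp only [lieDerivMetric, inner_smul_left, smul_eq_mul, conj_trivial]
    ring
  add {Y Y'} hY hY' := by
    rw [lieDerivMetric, mvfderiv_inner_add_left hY hY' hZ, mlieBracket_add_right hY hY',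
      inner_add_left, Pi.add_apply, inner_add_left]
    simp only [lieDerivMetric]
    ring

theorem lieDerivMetric_comm (ξ Y Z : Π x : G, TangentSpace I x) (x : G) :
    lieDerivMetric ξ Y Z x = lieDerivMetric ξ Z Y x := by
  simp only [lieDerivMetric, fun y ↦ real_inner_comm (Y y) (Z y),
    real_inner_comm (mlieBracket I ξ Y x), real_inner_comm (mlieBracket I ξ Z x)]
  ring

theorem tensorialAt_lieDerivMetric_right {ξ Y : Π x : G, TangentSpace I x} {x : G}
    (hY : MDiffAt (T% Y) x) : TensorialAt I E (fun Z ↦ lieDerivMetric ξ Y Z x) x := by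
  simp only [lieDerivMetric_comm ξ Y]
  exact tensorialAt_lieDerivMetric_left hY

theorem lieDerivMetric_mulInvariantVectorField (hG : IsLeftInvariantMetric I G)
    (ξ v w : TangentSpace I (1 : G)) (x : G) :
    lieDerivMetric (I := I) (mulInvariantVectorField ξ) (mulInvariantVectorField v)
        (mulInvariantVectorField w) x
      = - (inner ℝ (lieBracketₗ I G ξ v) w + inner ℝ v (lieBracketₗ I G ξ w)) := by
  simp only [lieDerivMetric, mlieBracket_mulInvariantVectorField,
    hG.inner_mulInvariantVectorField, mvfderiv_const, _root_.zero_apply]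
  ring

/-- A left-invariant vector field is Killing if and only if its adjoint endomorphism is
skew-symmetric. -/
theorem isKilling_mulInvariantVectorField_iff (hG : IsLeftInvariantMetric I G)
    (ξ : TangentSpace I (1 : G)) :
    IsKilling (I := I) (mulInvariantVectorField ξ) ↔
      ∀ v w, inner ℝ (lieBracketₗ I G ξ v) w + inner ℝ v (lieBracketₗ I G ξ w) = 0 := by
  constructor
  · intro h v w
    have := h 1 _ _ (mdifferentiableAt_mulInv v 1) (mdifferentiableAt_mulInv w 1)
    rwa [lieDerivMetric_mulInvariantVectorField hG, neg_eq_zero] at this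
  · intro h x Y Z hY hZ
    obtain ⟨v, hv⟩ := (leftTranslate hG x).surjective (Y x)
    obtain ⟨w, hw⟩ := (leftTranslate hG x).surjective (Z x)
    have := TensorialAt.pointwise₂ (I := I) (F := E) (F' := E)
      (Φ := fun Y Z ↦ lieDerivMetric (mulInvariantVectorField ξ) Y Z x)
      (fun _ ↦ tensorialAt_lieDerivMetric_left) (fun _ ↦ tensorialAt_lieDerivMetric_right)
      hY (mdifferentiableAt_mulInv v x) hZ (mdifferentiableAt_mulInv w x) hv.symm hw.symm
    rw [this, lieDerivMetric_mulInvariantVectorField hG, h, neg_zero]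

/-! ### Left-invariant frames -/

/-- A vector field, expanded in an orthonormal frame of left-invariant vector fields. -/
theorem eq_sum_inner_smul_mulInvariantVectorField (hG : IsLeftInvariantMetric I G)
    {ι : Type*} [Fintype ι] (e : OrthonormalBasis ι ℝ (TangentSpace I (1 : G)))
    (Z : Π x : G, TangentSpace I x) :
    Z = ∑ i, (fun y ↦ (inner ℝ (mulInvariantVectorField (e i) y) (Z y) : ℝ)) •
      mulInvariantVectorField (e i) := by
  ext x
  rw [Finset.sum_apply]
  exact ((e.map (leftTranslate hG x)).sum_repr' (Z x)).symm

/-- The derivative of a `C²` function along a left-invariant field is differentiable; it is a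
component of the bracket of `v` and `f v`. -/
theorem mdifferentiableAt_mvfderiv_mulInv (hG : IsLeftInvariantMetric I G) {f : G → ℝ} {x : G}
    (hf : ContMDiffAt I 𝓘(ℝ, ℝ) 2 f x) (v : TangentSpace I (1 : G)) :
    MDiffAt (fun y ↦ mvfderiv I f y (mulInvariantVectorField v y)) x := by
  rcases eq_or_ne v 0 with rfl | hv
  · have : (fun y ↦ mvfderiv I f y (mulInvariantVectorField (0 : TangentSpace I (1 : G)) y))
        = fun _ ↦ 0 := by
      ext y
      rw [← leftTranslate_apply hG, map_zero, map_zero]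
    rw [this]
    exact mdifferentiableAt_const
  -- `[v, f v] = (v f) v`, and the left-hand side is of class `C¹`.
  have h1 : CMDiffAt 2 (T% (f • mulInvariantVectorField v)) x :=
    hf.smul_section (contMDiff_two_mulInvariantVectorField v x)
  have h2 : MDiffAt (T% (mlieBracket I (mulInvariantVectorField v)
      (f • mulInvariantVectorField v))) x :=
    (contMDiffAt_one_mlieBracket (contMDiff_two_mulInvariantVectorField v x) h1).mdifferentiableAt
      (by simp)
  have h3 := (mdifferentiableAt_inner h2 (mdifferentiableAt_mulInv v x)).const_smul
    (inner ℝ v v : ℝ)⁻¹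
  refine h3.congr_of_eventuallyEq ?_
  filter_upwards [eventually_mdifferentiableAt hf] with y hy
  have hv' : (inner ℝ v v : ℝ) ≠ 0 := inner_self_ne_zero.2 hv
  simp only [Pi.smul_apply]
  rw [mlieBracket_smul_right hy (mdifferentiableAt_mulInv v y),
    mlieBracket_self, Pi.zero_apply, smul_zero, add_zero, inner_smul_left,
    hG.inner_mulInvariantVectorField]
  simp
  field_simp

end LeftInvariant

/-! ### Covariant derivatives of multiples of left-invariant fields -/

section LeftInvariant

variable {E : Type*} [NormedAddCommGroup E] [NormedSpace ℝ E]
  {H : Type*} [TopologicalSpace H] {I : ModelWithCorners ℝ E H}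
  {G : Type*} [TopologicalSpace G] [ChartedSpace H G] [Group G] [LieGroup I ∞ G]
  [CompleteSpace E] [FiniteDimensional ℝ E]

/-- The commutator of the derivations given by two vector fields is the derivation given by their
Lie bracket; this is the Jacobi identity for `U`, `V` and `f W`. -/
theorem mvfderiv_mvfderiv_sub_smul {f : G → ℝ} {x : G} (hf : ContMDiffAt I 𝓘(ℝ, ℝ) 2 f x)
    {U V W : Π x : G, TangentSpace I x} (hU : CMDiffAt 2 (T% U) x) (hV : CMDiffAt 2 (T% V) x)
    (hW : CMDiffAt 2 (T% W) x) (hUf : MDiffAt (fun y ↦ mvfderiv I f y (U y)) x)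
    (hVf : MDiffAt (fun y ↦ mvfderiv I f y (V y)) x) :
    (mvfderiv I (fun y ↦ mvfderiv I f y (V y)) x (U x)
      - mvfderiv I (fun y ↦ mvfderiv I f y (U y)) x (V x)
      - mvfderiv I f x (mlieBracket I U V x)) • W x = 0 := by
  have key : ∀ {V' : Π x : G, TangentSpace I x},
      mlieBracket I V' (f • W) =ᶠ[𝓝 x]
        (fun y ↦ mvfderiv I f y (V' y)) • W + f • mlieBracket I V' W := by
    intro V'
    filter_upwards [eventually_mdifferentiableAt hf, eventually_mdifferentiableAt hW] with y h1 h2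
    exact mlieBracket_smul_right h1 h2
  have hf1 : MDiffAt f x := hf.mdifferentiableAt (by simp)
  have hW1 : MDiffAt (T% W) x := hW.mdifferentiableAt (by simp)
  have hVW := (contMDiffAt_one_mlieBracket hV hW).mdifferentiableAt (by simp)
  have hUW := (contMDiffAt_one_mlieBracket hU hW).mdifferentiableAt (by simp)
  have h2 : minSmoothness ℝ 2 = 2 := minSmoothness_of_isRCLikeNormedField
  have J := leibniz_identity_mlieBracket_apply (h2 ▸ hU) (h2 ▸ hV)
    (h2 ▸ (hf.smul_section hW : CMDiffAt 2 (T% (f • W)) x))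
  have J' := leibniz_identity_mlieBracket_apply (h2 ▸ hU) (h2 ▸ hV) (h2 ▸ hW)
  rw [Filter.EventuallyEq.rfl.mlieBracket_vectorField_eq key,
    Filter.EventuallyEq.rfl.mlieBracket_vectorField_eq key,
    mlieBracket_smul_right hf1 hW1,
    mlieBracket_add_right (hVf.smul_section hW1) (hf1.smul_section hVW),
    mlieBracket_add_right (hUf.smul_section hW1) (hf1.smul_section hUW),
    mlieBracket_smul_right hVf hW1, mlieBracket_smul_right hUf hW1,
    mlieBracket_smul_right hf1 hVW, mlieBracket_smul_right hf1 hUW, J'] at J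
  rw [← sub_eq_zero] at J
  rw [← J]
  module

variable [RiemannianBundle (fun x : G ↦ TangentSpace I x)]
  [IsContMDiffRiemannianBundle I ∞ E (fun x : G ↦ TangentSpace I x)]

theorem leviCivita_add {Y Z : Π x : G, TangentSpace I x} {x : G} (hY : MDiffAt (T% Y) x)
    (hZ : MDiffAt (T% Z) x) (u : TangentSpace I x) :
    leviCivita I G (Y + Z) x u = leviCivita I G Y x u + leviCivita I G Z x u :=
  DFunLike.congr_fun ((leviCivita I G).isCovariantDerivativeOnUniv.add hY hZ) u

theorem leviCivita_smul {f : G → ℝ} {Z : Π x : G, TangentSpace I x} {x : G} (hf : MDiffAt f x)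
    (hZ : MDiffAt (T% Z) x) (u : TangentSpace I x) :
    leviCivita I G (f • Z) x u = mvfderiv I f x u • Z x + f x • leviCivita I G Z x u := by
  rw [add_comm]
  exact DFunLike.congr_fun ((leviCivita I G).isCovariantDerivativeOnUniv.leibniz hZ hf) u

theorem leviCivita_congr {Y Z : Π x : G, TangentSpace I x} {x : G} (hZ : MDiffAt (T% Z) x)
    (h : Y =ᶠ[𝓝 x] Z) : leviCivita I G Y x = leviCivita I G Z x := by
  have hY : MDiffAt (T% Y) x := by
    refine hZ.congr_of_eventuallyEq ?_
    filter_upwards [h] with y hy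
    simp [hy]
  exact (leviCivita I G).isCovariantDerivativeOnUniv.congr_of_eventuallyEq hY hZ
    Filter.univ_mem h

variable (I G) in
/-- The Lie derivative along `ξ` of the Levi-Civita product on the Lie algebra:
`(v, w) ↦ [ξ, ∇_v w] - ∇_[ξ, v] w - ∇_v [ξ, w]`. -/
def lieDerivLeviCivitaₗ (ξ v : TangentSpace I (1 : G)) :
    TangentSpace I (1 : G) →ₗ[ℝ] TangentSpace I (1 : G) :=
  lieBracketₗ I G ξ ∘ₗ leviCivitaₗ I G v - leviCivitaₗ I G (lieBracketₗ I G ξ v)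
    - leviCivitaₗ I G v ∘ₗ lieBracketₗ I G ξ

theorem lieDerivLeviCivitaₗ_apply (ξ v w : TangentSpace I (1 : G)) :
    lieDerivLeviCivitaₗ I G ξ v w = lieBracketₗ I G ξ (leviCivitaₗ I G v w)
      - leviCivitaₗ I G (lieBracketₗ I G ξ v) w - leviCivitaₗ I G v (lieBracketₗ I G ξ w) := rfl

theorem leviCivita_smul_mulInv (hG : IsLeftInvariantMetric I G) {f : G → ℝ} {x : G}
    (hf : ContMDiffAt I 𝓘(ℝ, ℝ) 2 f x) (v w : TangentSpace I (1 : G)) :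
    (fun y ↦ leviCivita I G (f • mulInvariantVectorField w) y (mulInvariantVectorField v y))
      =ᶠ[𝓝 x] (fun y ↦ mvfderiv I f y (mulInvariantVectorField v y)) • mulInvariantVectorField w
        + f • mulInvariantVectorField (leviCivitaₗ I G v w) := by
  filter_upwards [eventually_mdifferentiableAt hf] with y h1
  rw [leviCivita_smul h1 (mdifferentiableAt_mulInv w y), leviCivita_mulInvariantVectorField hG]
  rfl

theorem mlieBracket_smul_mulInv {f : G → ℝ} {x : G}
    (hf : ContMDiffAt I 𝓘(ℝ, ℝ) 2 f x) (v w : TangentSpace I (1 : G)) :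
    mlieBracket I (mulInvariantVectorField v) (f • mulInvariantVectorField w)
      =ᶠ[𝓝 x] (fun y ↦ mvfderiv I f y (mulInvariantVectorField v y)) • mulInvariantVectorField w
        + f • mulInvariantVectorField (lieBracketₗ I G v w) := by
  filter_upwards [eventually_mdifferentiableAt hf] with y h1
  rw [mlieBracket_smul_right h1 (mdifferentiableAt_mulInv w y),
    mlieBracket_mulInvariantVectorField]
  rfl

/-- The terms with derivatives of `f` cancel, by `mvfderiv_mvfderiv_sub_smul`. -/
theorem lieDerivConnection_smul_mulInv (hG : IsLeftInvariantMetric I G) {f : G → ℝ} {x : G}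
    (hf : ContMDiffAt I 𝓘(ℝ, ℝ) 2 f x) (ξ v w : TangentSpace I (1 : G)) :
    lieDerivConnection (I := I) (mulInvariantVectorField ξ) (mulInvariantVectorField v)
        (f • mulInvariantVectorField w) x
      = f x • mulInvariantVectorField (lieDerivLeviCivitaₗ I G ξ v w) x := by
  have hf1 : MDiffAt f x := hf.mdifferentiableAt (by simp)
  have hd := fun u ↦ mdifferentiableAt_mvfderiv_mulInv hG hf u
  have hF := fun u ↦ mdifferentiableAt_mulInv (I := I) u x
  have hc := fun u ↦ contMDiff_two_mulInvariantVectorField (I := I) u x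
  have hsym := mvfderiv_mvfderiv_sub_smul hf (hc ξ) (hc v) (hc w) (hd ξ) (hd v)
  have e1 := leviCivita_congr (mdifferentiableAt_add_section ((hd ξ).smul_section (hF w))
    (hf1.smul_section (hF _))) (mlieBracket_smul_mulInv hf ξ w)
  rw [lieDerivConnection, Filter.EventuallyEq.rfl.mlieBracket_vectorField_eq
      (leviCivita_smul_mulInv hG hf v w), e1,
    mlieBracket_add_right ((hd v).smul_section (hF w)) (hf1.smul_section (hF _)),
    mlieBracket_smul_right (hd v) (hF w), mlieBracket_smul_right hf1 (hF _),
    leviCivita_add ((hd ξ).smul_section (hF w)) (hf1.smul_section (hF _)),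
    leviCivita_smul (hd ξ) (hF w), leviCivita_smul hf1 (hF _), leviCivita_smul hf1 (hF _)]
  rw [mlieBracket_mulInvariantVectorField] at hsym
  simp only [mlieBracket_mulInvariantVectorField, leviCivita_mulInvariantVectorField hG]
  rw [lieDerivLeviCivitaₗ_apply]
  simp only [← leftTranslate_apply hG, map_sub] at hsym ⊢
  rw [← sub_eq_zero]
  rw [← hsym]
  module

end LeftInvariant

/-! ### Tensoriality of the Lie derivative of the connection -/

section LeftInvariant

variable {E : Type*} [NormedAddCommGroup E] [NormedSpace ℝ E]
  {H : Type*} [TopologicalSpace H] {I : ModelWithCorners ℝ E H}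
  {G : Type*} [TopologicalSpace G] [ChartedSpace H G] [Group G] [LieGroup I ∞ G]
  [CompleteSpace E] [FiniteDimensional ℝ E]
  [RiemannianBundle (fun x : G ↦ TangentSpace I x)]
  [IsContMDiffRiemannianBundle I ∞ E (fun x : G ↦ TangentSpace I x)]

theorem lieDerivConnection_add_right {ξ Y Z Z' : Π x : G, TangentSpace I x} {x : G}
    (hξ : CMDiffAt 2 (T% ξ) x) (hZ : CMDiffAt 2 (T% Z) x) (hZ' : CMDiffAt 2 (T% Z') x)
    (h : MDiffAt (T% (fun y ↦ leviCivita I G Z y (Y y))) x)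
    (h' : MDiffAt (T% (fun y ↦ leviCivita I G Z' y (Y y))) x) :
    lieDerivConnection ξ Y (Z + Z') x
      = lieDerivConnection ξ Y Z x + lieDerivConnection ξ Y Z' x := by
  have e1 : (fun y ↦ leviCivita I G (Z + Z') y (Y y)) =ᶠ[𝓝 x]
      (fun y ↦ leviCivita I G Z y (Y y)) + (fun y ↦ leviCivita I G Z' y (Y y)) := by
    filter_upwards [eventually_mdifferentiableAt hZ, eventually_mdifferentiableAt hZ']
      with y h1 h2
    exact leviCivita_add h1 h2 _
  have e2 : mlieBracket I ξ (Z + Z') =ᶠ[𝓝 x] mlieBracket I ξ Z + mlieBracket I ξ Z' := by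
    filter_upwards [eventually_mdifferentiableAt hZ, eventually_mdifferentiableAt hZ']
      with y h1 h2
    exact mlieBracket_add_right h1 h2
  have b1 := (contMDiffAt_one_mlieBracket hξ hZ).mdifferentiableAt (by simp)
  have b2 := (contMDiffAt_one_mlieBracket hξ hZ').mdifferentiableAt (by simp)
  rw [lieDerivConnection, Filter.EventuallyEq.rfl.mlieBracket_vectorField_eq e1,
    mlieBracket_add_right h h', leviCivita_congr (mdifferentiableAt_add_section b1 b2) e2,
    leviCivita_add b1 b2, leviCivita_add (hZ.mdifferentiableAt (by simp))
      (hZ'.mdifferentiableAt (by simp))]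
  simp only [lieDerivConnection]
  abel

/-- The covariant and Lie derivatives of a `C²` field `Z` in left-invariant directions: `∇_v Z` is
differentiable, and `(L_ξ ∇)(v, Z)` depends on the value of `Z` only. The field `Z` is expanded in
a left-invariant frame. -/
theorem lieDerivConnection_mulInv_left (hG : IsLeftInvariantMetric I G)
    {Z : Π x : G, TangentSpace I x} {x : G} (hZ : CMDiffAt 2 (T% Z) x)
    (ξ v : TangentSpace I (1 : G)) :
    MDiffAt (T% (fun y ↦ leviCivita I G Z y (mulInvariantVectorField v y))) x ∧
    lieDerivConnection (mulInvariantVectorField ξ) (mulInvariantVectorField v) Z x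
      = mulInvariantVectorField
          (lieDerivLeviCivitaₗ I G ξ v ((leftTranslate hG x).symm (Z x))) x := by
  have hc := fun u ↦ contMDiff_two_mulInvariantVectorField (I := I) u x
  let P : (Π x : G, TangentSpace I x) → Prop := fun Z ↦ CMDiffAt 2 (T% Z) x ∧
    MDiffAt (T% (fun y ↦ leviCivita I G Z y (mulInvariantVectorField v y))) x ∧
    lieDerivConnection (mulInvariantVectorField ξ) (mulInvariantVectorField v) Z x
      = mulInvariantVectorField
          (lieDerivLeviCivitaₗ I G ξ v ((leftTranslate hG x).symm (Z x))) x
  have hadd : ∀ Z Z', P Z → P Z' → P (Z + Z') := by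
    rintro Z Z' ⟨h1, h2, h3⟩ ⟨h1', h2', h3'⟩
    refine ⟨h1.add_section h1', ?_, ?_⟩
    · refine (mdifferentiableAt_add_section h2 h2').congr_of_eventuallyEq ?_
      filter_upwards [eventually_mdifferentiableAt h1, eventually_mdifferentiableAt h1']
        with y h3 h4
      rw [leviCivita_add h3 h4]
      rfl
    · rw [lieDerivConnection_add_right (hc ξ) h1 h1' h2 h2', h3, h3', Pi.add_apply]
      simp only [← leftTranslate_apply hG, map_add]
  have hsmul : ∀ (f : G → ℝ) (w : TangentSpace I (1 : G)), ContMDiffAt I 𝓘(ℝ, ℝ) 2 f x →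
      P (f • mulInvariantVectorField w) := by
    intro f w hf
    refine ⟨hf.smul_section (hc w), ?_, ?_⟩
    · have h1 := mdifferentiableAt_add_section
        ((mdifferentiableAt_mvfderiv_mulInv hG hf v).smul_section (mdifferentiableAt_mulInv w x))
        ((hf.mdifferentiableAt (by simp)).smul_section
          (mdifferentiableAt_mulInv (leviCivitaₗ I G v w) x))
      refine h1.congr_of_eventuallyEq ?_
      filter_upwards [leviCivita_smul_mulInv hG hf v w] with y hy
      rw [hy]
    · rw [lieDerivConnection_smul_mulInv hG hf, Pi.smul_apply']
      simp only [← leftTranslate_apply hG, map_smul, LinearIsometryEquiv.symm_apply_apply]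
  have hzero : P 0 := by
    have := hsmul (fun _ ↦ 0) 0 contMDiffAt_const
    rwa [show (fun _ : G ↦ (0 : ℝ)) • mulInvariantVectorField (0 : TangentSpace I (1 : G)) = 0 by
      ext y; simp] at this
  have hP : P Z := by
    let e := stdOrthonormalBasis ℝ (TangentSpace I (1 : G))
    rw [eq_sum_inner_smul_mulInvariantVectorField hG e Z]
    exact Finset.sum_induction _ P hadd hzero fun i _ ↦ hsmul _ _
      (ContMDiffAt.inner_bundle (IB := I) (F := E) (E := fun y : G ↦ TangentSpace I y)
        (b := fun y ↦ y) (hc (e i)) hZ)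
  exact hP.2

theorem mdifferentiableAt_leviCivita_apply (hG : IsLeftInvariantMetric I G)
    {Y Z : Π x : G, TangentSpace I x} {x : G} (hY : MDiffAt (T% Y) x)
    (hZ : CMDiffAt 2 (T% Z) x) : MDiffAt (T% (fun y ↦ leviCivita I G Z y (Y y))) x := by
  let e := stdOrthonormalBasis ℝ (TangentSpace I (1 : G))
  have h : ∀ y, leviCivita I G Z y (Y y) = ∑ i,
      (inner ℝ (mulInvariantVectorField (e i) y) (Y y) : ℝ) •
        leviCivita I G Z y (mulInvariantVectorField (e i) y) := by
    intro y
    conv_lhs => rw [eq_sum_inner_smul_mulInvariantVectorField hG e Y, Finset.sum_apply]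
    rw [map_sum]
    exact Finset.sum_congr rfl fun i _ ↦ map_smul _ _ _
  simp only [h]
  exact .sum_section fun i _ ↦ (mdifferentiableAt_inner (mdifferentiableAt_mulInv (e i) x)
    hY).smul_section (lieDerivConnection_mulInv_left hG hZ 0 (e i)).1

theorem tensorialAt_lieDerivConnection (hG : IsLeftInvariantMetric I G)
    {ξ Z : Π x : G, TangentSpace I x} {x : G} (hZ : CMDiffAt 2 (T% Z) x) :
    TensorialAt I E (fun Y ↦ lieDerivConnection ξ Y Z x) x where
  smul {f Y} hf hY := by
    have h : (fun y ↦ leviCivita I G Z y ((f • Y) y)) = f • fun y ↦ leviCivita I G Z y (Y y) := by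
      ext y
      exact map_smul _ _ _
    rw [lieDerivConnection, h, mlieBracket_smul_right hf
      (mdifferentiableAt_leviCivita_apply hG hY hZ), mlieBracket_smul_right hf hY,
      Pi.smul_apply', map_smul, map_add, map_smul, map_smul]
    simp only [lieDerivConnection]
    module
  add {Y Y'} hY hY' := by
    have h : (fun y ↦ leviCivita I G Z y ((Y + Y') y))
        = (fun y ↦ leviCivita I G Z y (Y y)) + fun y ↦ leviCivita I G Z y (Y' y) := by
      ext y
      exact map_add _ _ _
    rw [lieDerivConnection, h, mlieBracket_add_right
      (mdifferentiableAt_leviCivita_apply hG hY hZ) (mdifferentiableAt_leviCivita_apply hG hY' hZ),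
      mlieBracket_add_right hY hY', Pi.add_apply, map_add, map_add]
    simp only [lieDerivConnection]
    abel

/-- The Lie derivative of the Levi-Civita connection along a left-invariant field is the
left-invariant tensor given by the product on the Lie algebra. -/
theorem lieDerivConnection_eq (hG : IsLeftInvariantMetric I G) {Y Z : Π x : G, TangentSpace I x}
    {x : G} (hY : MDiffAt (T% Y) x) (hZ : CMDiffAt 2 (T% Z) x) (ξ : TangentSpace I (1 : G)) :
    lieDerivConnection (mulInvariantVectorField ξ) Y Z x
      = mulInvariantVectorField (lieDerivLeviCivitaₗ I G ξ ((leftTranslate hG x).symm (Y x))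
          ((leftTranslate hG x).symm (Z x))) x := by
  rw [← (lieDerivConnection_mulInv_left hG hZ ξ _).2]
  exact (tensorialAt_lieDerivConnection hG hZ).pointwise hY (mdifferentiableAt_mulInv _ x)
    ((leftTranslate hG x).apply_symm_apply (Y x)).symm

variable (I) in
/-- The standard orthonormal basis of the tangent space at `x`, translated to the identity. -/
def leftFrame (hG : IsLeftInvariantMetric I G) (x : G) :
    OrthonormalBasis (Fin (Module.finrank ℝ (TangentSpace I x))) ℝ (TangentSpace I (1 : G)) :=
  (stdOrthonormalBasis ℝ (TangentSpace I x)).map (leftTranslate hG x).symm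

theorem traceLieDerivConnection_eq (hG : IsLeftInvariantMetric I G)
    (ξ : TangentSpace I (1 : G)) (x : G) :
    traceLieDerivConnection (mulInvariantVectorField ξ) x = mulInvariantVectorField
      (∑ i, lieDerivLeviCivitaₗ I G ξ (leftFrame I hG x i) (leftFrame I hG x i)) x := by
  rw [← leftTranslate_apply hG, map_sum]
  refine Finset.sum_congr rfl fun i _ ↦ ?_
  rw [lieDerivConnection_eq hG (mdifferentiableAt_extend ..) (contMDiffAt_extend ..),
    extend_apply_self]
  rfl

end LeftInvariant

/-! ### The multiplication in a chart at the identity -/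

set_option synthInstance.maxHeartbeats 200000 in
/-- The quotient rule in a Banach algebra, at a point where both curves pass through `1`. -/
theorem hasDerivAt_ringInverse_mul {R : Type*} [NormedRing R] [NormedAlgebra ℝ R]
    [HasSummableGeomSeries R] {p q : ℝ → R} {p' q' : R} {t : ℝ} (hp : HasDerivAt p p' t)
    (hq : HasDerivAt q q' t) (hp1 : p t = 1) (hq1 : q t = 1) :
    HasDerivAt (fun s ↦ Ring.inverse (p s) * q s) (q' - p') t := by
  have h1 := hasFDerivAt_ringInverse (𝕜 := ℝ) (1 : Rˣ)
  rw [show ((1 : Rˣ) : R) = p t from hp1.symm] at h1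
  have h2 := (h1.comp_hasDerivAt t hp).mul hq
  refine h2.congr_deriv ?_
  simp [hp1, hq1, sub_eq_neg_add]

section Chart

variable {E : Type*} [NormedAddCommGroup E] [NormedSpace ℝ E]
  {H : Type*} [TopologicalSpace H] {I : ModelWithCorners ℝ E H}
  {G : Type*} [TopologicalSpace G] [ChartedSpace H G] [Group G] [LieGroup I ∞ G]

variable (I) in
/-- The derivative at the identity of right translation by `a`. -/
def rightDeriv (a : G) : TangentSpace I (1 : G) →L[ℝ] TangentSpace I a :=
  mfderiv I I (fun y ↦ y * a) (1 : G)

variable (I) in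
/-- The derivative at the identity of left translation by `a`. -/
def leftDeriv (a : G) : TangentSpace I (1 : G) →L[ℝ] TangentSpace I a :=
  mfderiv I I (fun y ↦ a * y) (1 : G)

variable (I G) in
/-- The multiplication of `G`, read in the preferred chart at the identity. -/
def chartMul (p : E × E) : E :=
  extChartAt I (1 : G) ((extChartAt I (1 : G)).symm p.1 * (extChartAt I (1 : G)).symm p.2)

variable [I.Boundaryless]

theorem extChartAt_one_target_mem_nhds :
    (extChartAt I (1 : G)).target ∈ 𝓝 (extChartAt I (1 : G) 1) := extChartAt_target_mem_nhds _

theorem contDiffAt_chartMul :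
    ContDiffAt ℝ 2 (chartMul I G) (extChartAt I (1 : G) 1, extChartAt I (1 : G) 1) := by
  set e := extChartAt I (1 : G) 1 with he
  have hs : ContMDiffAt 𝓘(ℝ, E) I 2 (extChartAt I (1 : G)).symm e :=
    (contMDiffOn_extChartAt_symm (1 : G)).contMDiffAt extChartAt_one_target_mem_nhds
  have h1 : ContMDiffAt 𝓘(ℝ, E × E) I 2 (fun p : E × E ↦ (extChartAt I (1 : G)).symm p.1) (e, e) :=
    hs.comp (e, e) (contDiff_fst.contMDiff.contMDiffAt)
  have h2 : ContMDiffAt 𝓘(ℝ, E × E) I 2 (fun p : E × E ↦ (extChartAt I (1 : G)).symm p.2) (e, e) :=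
    hs.comp (e, e) (contDiff_snd.contMDiff.contMDiffAt)
  have hsymm : (extChartAt I (1 : G)).symm e = 1 := extChartAt_to_inv _
  have h3 : ContMDiffAt I 𝓘(ℝ, E) 2 (extChartAt I (1 : G))
      ((extChartAt I (1 : G)).symm e * (extChartAt I (1 : G)).symm e) := by
    rw [hsymm, one_mul]
    exact contMDiffAt_extChartAt
  have : ContMDiffMul I 2 G := ContMDiffMul.of_le (n := ∞) (by norm_cast)
  exact (ContMDiffAt.comp (e, e) h3 (h1.mul h2)).contDiffAt

theorem chartMul_one_right {z : E} (hz : z ∈ (extChartAt I (1 : G)).target) :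
    chartMul I G (z, extChartAt I (1 : G) 1) = z := by
  simp only [chartMul]
  rw [extChartAt_to_inv, mul_one, (extChartAt I (1 : G)).right_inv hz]

theorem chartMul_one_left {z : E} (hz : z ∈ (extChartAt I (1 : G)).target) :
    chartMul I G (extChartAt I (1 : G) 1, z) = z := by
  simp only [chartMul]
  rw [extChartAt_to_inv, one_mul, (extChartAt I (1 : G)).right_inv hz]

variable (I) in
/-- The derivative at `a` of the preferred chart at the identity. -/
def chartDeriv (a : G) : TangentSpace I a →L[ℝ] E :=
  mfderiv I 𝓘(ℝ, E) (extChartAt I (1 : G)) a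

/-- The derivative at the identity of a map `f`, read in the chart at the identity. -/
theorem hasFDerivAt_extChartAt_comp {f : G → G} {a : G}
    {L : TangentSpace I (1 : G) →L[ℝ] TangentSpace I a}
    (hf : HasMFDerivAt I I f 1 L) (hfa : f 1 = a) (ha : a ∈ (extChartAt I (1 : G)).source) :
    HasFDerivAt (fun z ↦ extChartAt I (1 : G) (f ((extChartAt I (1 : G)).symm z)))
      (chartDeriv I a ∘L L : E →L[ℝ] E) (extChartAt I (1 : G) 1) := by
  subst hfa
  have h0 : MDifferentiableAt 𝓘(ℝ, E) I (extChartAt I (1 : G)).symm (extChartAt I (1 : G) 1) := by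
    have h := mdifferentiableWithinAt_extChartAt_symm (I := I) (mem_extChartAt_target (1 : G))
    rwa [I.range_eq_univ, mdifferentiableWithinAt_univ] at h
  have h1 : HasMFDerivAt 𝓘(ℝ, E) I (extChartAt I (1 : G)).symm (extChartAt I (1 : G) 1)
      (ContinuousLinearMap.id ℝ E) := by
    have h := mfderivWithin_range_extChartAt_symm (I := I) (x := (1 : G))
    rw [I.range_eq_univ, mfderivWithin_univ] at h
    exact h ▸ h0.hasMFDerivAt
  have hsymm : (extChartAt I (1 : G)).symm (extChartAt I (1 : G) 1) = 1 := extChartAt_to_inv _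
  have hL : ∀ y : G, y = 1 → HasMFDerivAt I 𝓘(ℝ, E) (extChartAt I (1 : G) ∘ f) y
      (chartDeriv I (f 1) ∘L L : E →L[ℝ] E) := by
    rintro _ rfl
    exact (mdifferentiableAt_extChartAt (by rwa [extChartAt_source] at ha)).hasMFDerivAt.comp _ hf
  exact hasMFDerivAt_iff_hasFDerivAt.1 ((hL _ hsymm).comp _ h1)

/-- Left translation in the chart at the identity. -/
theorem chartDeriv_comp_leftDeriv {a : G} (ha : a ∈ (extChartAt I (1 : G)).source)
    (hd : DifferentiableAt ℝ (chartMul I G) (extChartAt I (1 : G) a, extChartAt I (1 : G) 1)) :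
    chartDeriv I a ∘L leftDeriv I a
      = fderiv ℝ (chartMul I G) (extChartAt I (1 : G) a, extChartAt I (1 : G) 1)
          ∘L ContinuousLinearMap.inr ℝ E E := by
  have h1 : HasFDerivAt (fun z ↦ chartMul I G (extChartAt I (1 : G) a, z))
      (fderiv ℝ (chartMul I G) (extChartAt I (1 : G) a, extChartAt I (1 : G) 1)
          ∘L ContinuousLinearMap.inr ℝ E E) (extChartAt I (1 : G) 1) :=
    hd.hasFDerivAt.comp (extChartAt I (1 : G) 1) (hasFDerivAt_prodMk_right _ _)
  have h2 := hasFDerivAt_extChartAt_comp (I := I) (L := leftDeriv I a)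
    (mdifferentiableAt_mul_left a 1).hasMFDerivAt (mul_one a) ha
  simp only [chartMul, (extChartAt I (1 : G)).left_inv ha] at h1
  exact (h1.unique h2).symm

/-- Right translation in the chart at the identity. -/
theorem chartDeriv_comp_rightDeriv {a : G} (ha : a ∈ (extChartAt I (1 : G)).source)
    (hd : DifferentiableAt ℝ (chartMul I G) (extChartAt I (1 : G) 1, extChartAt I (1 : G) a)) :
    chartDeriv I a ∘L rightDeriv I a
      = fderiv ℝ (chartMul I G) (extChartAt I (1 : G) 1, extChartAt I (1 : G) a)
          ∘L ContinuousLinearMap.inl ℝ E E := by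
  have h1 : HasFDerivAt (fun z ↦ chartMul I G (z, extChartAt I (1 : G) a))
      (fderiv ℝ (chartMul I G) (extChartAt I (1 : G) 1, extChartAt I (1 : G) a)
          ∘L ContinuousLinearMap.inl ℝ E E) (extChartAt I (1 : G) 1) :=
    HasFDerivAt.comp (f := fun z ↦ (z, extChartAt I (1 : G) a)) (extChartAt I (1 : G) 1)
      hd.hasFDerivAt (hasFDerivAt_prodMk_left _ _)
  have h2 := hasFDerivAt_extChartAt_comp (I := I) (L := rightDeriv I a)
    (mdifferentiableAt_mul_right a 1).hasMFDerivAt (one_mul a) ha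
  simp only [chartMul, (extChartAt I (1 : G)).left_inv ha] at h1
  exact (h1.unique h2).symm

end Chart

/-! ### The Lie bracket in a chart at the identity -/

section Bracket

variable {E : Type*} [NormedAddCommGroup E] [NormedSpace ℝ E]
  {H : Type*} [TopologicalSpace H] {I : ModelWithCorners ℝ E H}
  {G : Type*} [TopologicalSpace G] [ChartedSpace H G] [Group G] [LieGroup I ∞ G]
  [I.Boundaryless]

/-- The vector field read in the chart, in terms of the derivative of the chart. -/
theorem mpullbackWithin_extChartAt_symm_apply {z : E}
    (hz : z ∈ (extChartAt I (1 : G)).target) (V : Π x : G, TangentSpace I x) :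
    mpullbackWithin 𝓘(ℝ, E) I (extChartAt I (1 : G)).symm V (Set.range I) z
      = chartDeriv I ((extChartAt I (1 : G)).symm z) (V ((extChartAt I (1 : G)).symm z)) := by
  have h : (mfderivWithin 𝓘(ℝ, E) I (extChartAt I (1 : G)).symm (Set.range I) z).inverse
      = chartDeriv I ((extChartAt I (1 : G)).symm z) :=
    ContinuousLinearMap.inverse_eq
      (mfderivWithin_extChartAt_symm_comp_mfderiv_extChartAt hz)
      (mfderiv_extChartAt_comp_mfderivWithin_extChartAt_symm hz)
  rw [mpullbackWithin_apply]
  exact DFunLike.congr_fun h _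

theorem eventually_differentiableAt_chartMul :
    ∀ᶠ p in 𝓝 (extChartAt I (1 : G) 1, extChartAt I (1 : G) 1),
      DifferentiableAt ℝ (chartMul I G) p :=
  ((contDiffAt_chartMul (I := I) (G := G)).eventually (by simp)).mono
    fun _ h ↦ h.differentiableAt (by simp)

/-- A left-invariant vector field in the chart at the identity. -/
theorem mpullbackWithin_mulInvariantVectorField_eventuallyEq (v : TangentSpace I (1 : G)) :
    mpullbackWithin 𝓘(ℝ, E) I (extChartAt I (1 : G)).symm (mulInvariantVectorField v) (Set.range I)
      =ᶠ[𝓝 (extChartAt I (1 : G) 1)]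
        fun z ↦ fderiv ℝ (chartMul I G) (z, extChartAt I (1 : G) 1) ((0 : E), (v : E)) := by
  have hc : Filter.Tendsto (fun z : E ↦ (z, extChartAt I (1 : G) 1)) (𝓝 (extChartAt I (1 : G) 1))
      (𝓝 (extChartAt I (1 : G) 1, extChartAt I (1 : G) 1)) :=
    (Continuous.prodMk continuous_id continuous_const).continuousAt
  filter_upwards [extChartAt_one_target_mem_nhds (I := I) (G := G),
    hc.eventually eventually_differentiableAt_chartMul] with z hz hd
  rw [mpullbackWithin_extChartAt_symm_apply hz]
  have h := chartDeriv_comp_leftDeriv ((extChartAt I (1 : G)).map_target hz)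
    (by rwa [(extChartAt I (1 : G)).right_inv hz])
  rw [(extChartAt I (1 : G)).right_inv hz] at h
  exact DFunLike.congr_fun h v

variable (I G) in
/-- The second derivative at the identity of the multiplication, read in the chart. -/
def chartMulDeriv₂ : E × E →L[ℝ] E × E →L[ℝ] E :=
  fderiv ℝ (fderiv ℝ (chartMul I G)) (extChartAt I (1 : G) 1, extChartAt I (1 : G) 1)

theorem hasFDerivAt_fderiv_chartMul :
    HasFDerivAt (fderiv ℝ (chartMul I G)) (chartMulDeriv₂ I G)
      (extChartAt I (1 : G) 1, extChartAt I (1 : G) 1) :=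
  ((contDiffAt_chartMul (I := I) (G := G)).fderiv_right (m := 1) (by norm_num)).differentiableAt
    (by simp) |>.hasFDerivAt

theorem chartMulDeriv₂_symm (p q : E × E) :
    chartMulDeriv₂ I G p q = chartMulDeriv₂ I G q p :=
  ((contDiffAt_chartMul (I := I) (G := G)).isSymmSndFDerivAt
    (by rw [minSmoothness_of_isRCLikeNormedField])).eq p q

theorem fderiv_chartMul_comp_inr :
    fderiv ℝ (chartMul I G) (extChartAt I (1 : G) 1, extChartAt I (1 : G) 1)
      ∘L ContinuousLinearMap.inr ℝ E E = ContinuousLinearMap.id ℝ E := by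
  have h1 : HasFDerivAt (fun z ↦ chartMul I G (extChartAt I (1 : G) 1, z))
      (fderiv ℝ (chartMul I G) (extChartAt I (1 : G) 1, extChartAt I (1 : G) 1)
          ∘L ContinuousLinearMap.inr ℝ E E) (extChartAt I (1 : G) 1) :=
    (contDiffAt_chartMul.differentiableAt (by simp)).hasFDerivAt.comp (extChartAt I (1 : G) 1)
      (hasFDerivAt_prodMk_right _ _)
  refine h1.unique ((hasFDerivAt_id _).congr_of_eventuallyEq ?_)
  filter_upwards [extChartAt_one_target_mem_nhds] with z hz using chartMul_one_left hz

theorem fderiv_chartMul_comp_inl :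
    fderiv ℝ (chartMul I G) (extChartAt I (1 : G) 1, extChartAt I (1 : G) 1)
      ∘L ContinuousLinearMap.inl ℝ E E = ContinuousLinearMap.id ℝ E := by
  have h1 : HasFDerivAt (fun z ↦ chartMul I G (z, extChartAt I (1 : G) 1))
      (fderiv ℝ (chartMul I G) (extChartAt I (1 : G) 1, extChartAt I (1 : G) 1)
          ∘L ContinuousLinearMap.inl ℝ E E) (extChartAt I (1 : G) 1) :=
    HasFDerivAt.comp (f := fun z ↦ (z, extChartAt I (1 : G) 1)) (extChartAt I (1 : G) 1)
      (contDiffAt_chartMul.differentiableAt (by simp)).hasFDerivAt (hasFDerivAt_prodMk_left _ _)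
  refine h1.unique ((hasFDerivAt_id _).congr_of_eventuallyEq ?_)
  filter_upwards [extChartAt_one_target_mem_nhds] with z hz using chartMul_one_right hz

variable [CompleteSpace E] [FiniteDimensional ℝ E]

/-- The Lie bracket is the antisymmetrization of the second derivative of the multiplication. -/
theorem lieBracketₗ_eq_chartMulDeriv₂ (v w : TangentSpace I (1 : G)) :
    (lieBracketₗ I G v w : E)
      = chartMulDeriv₂ I G ((v : E), (0 : E)) ((0 : E), (w : E))
        - chartMulDeriv₂ I G ((0 : E), (v : E)) ((w : E), (0 : E)) := by
  have hF : ∀ u : E, HasFDerivAt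
      (fun z ↦ fderiv ℝ (chartMul I G) (z, extChartAt I (1 : G) 1) ((0 : E), u))
      ((chartMulDeriv₂ I G ∘L ContinuousLinearMap.inl ℝ E E).flip ((0 : E), u))
      (extChartAt I (1 : G) 1) := fun u ↦ by
    have h := HasFDerivAt.comp (f := fun z ↦ (z, extChartAt I (1 : G) 1)) (extChartAt I (1 : G) 1)
      hasFDerivAt_fderiv_chartMul (hasFDerivAt_prodMk_left _ _)
    exact ((ContinuousLinearMap.apply ℝ E ((0 : E), u)).hasFDerivAt.comp _ h)
  have h0 : ∀ u : E, fderiv ℝ (chartMul I G) (extChartAt I (1 : G) 1, extChartAt I (1 : G) 1)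
      ((0 : E), u) = u := fun u ↦ DFunLike.congr_fun (fderiv_chartMul_comp_inr (I := I) (G := G)) u
  have h1 : (lieBracketₗ I G v w : E) = lieBracketWithin ℝ
      (mpullbackWithin 𝓘(ℝ, E) I (extChartAt I (1 : G)).symm (mulInvariantVectorField v)
        (Set.range I))
      (mpullbackWithin 𝓘(ℝ, E) I (extChartAt I (1 : G)).symm (mulInvariantVectorField w)
        (Set.range I))
      ((extChartAt I (1 : G)).symm ⁻¹' Set.univ ∩ Set.range I) (extChartAt I (1 : G) 1) := by
    have h2 : (lieBracketₗ I G v w : E) = mlieBracketWithin I (mulInvariantVectorField v)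
        (mulInvariantVectorField w) Set.univ (1 : G) := by
      rw [mlieBracketWithin_univ, mlieBracket_mulInvariantVectorField, mulInvariantVectorField_one]
    have h3 : (mfderiv I 𝓘(ℝ, E) (extChartAt I (1 : G)) (1 : G)).inverse
        = ContinuousLinearMap.id ℝ E := by
      rw [mfderiv_extChartAt_self]
      exact ContinuousLinearMap.inverse_id
    rw [h2, mlieBracketWithin_apply]
    exact DFunLike.congr_fun h3 _
  have key : ∀ V W V' W' : E → E, V =ᶠ[𝓝 (extChartAt I (1 : G) 1)] V' →
      W =ᶠ[𝓝 (extChartAt I (1 : G) 1)] W' →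
      lieBracketWithin ℝ V W ((extChartAt I (1 : G)).symm ⁻¹' Set.univ ∩ Set.range I)
        (extChartAt I (1 : G) 1) = lieBracket ℝ V' W' (extChartAt I (1 : G) 1) := by
    intro V W V' W' hV hW
    rw [I.range_eq_univ, Set.preimage_univ, Set.univ_inter, lieBracketWithin_univ,
      hV.lieBracket_vectorField_eq hW]
  have key' : ∀ a b : E, lieBracket ℝ
      (fun z ↦ fderiv ℝ (chartMul I G) (z, extChartAt I (1 : G) 1) ((0 : E), a))
      (fun z ↦ fderiv ℝ (chartMul I G) (z, extChartAt I (1 : G) 1) ((0 : E), b))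
      (extChartAt I (1 : G) 1)
      = chartMulDeriv₂ I G (a, (0 : E)) ((0 : E), b)
        - chartMulDeriv₂ I G ((0 : E), a) (b, (0 : E)) := by
    intro a b
    rw [lieBracket, (hF _).fderiv, (hF _).fderiv, h0, h0, chartMulDeriv₂_symm ((0 : E), a)]
    rfl
  exact (h1.trans (key _ _ _ _ (mpullbackWithin_mulInvariantVectorField_eventuallyEq v)
    (mpullbackWithin_mulInvariantVectorField_eventuallyEq w))).trans (key' v w)

end Bracket

/-! ### The derivative of the adjoint representation -/

section Adjoint

variable {E : Type*} [NormedAddCommGroup E] [NormedSpace ℝ E]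
  {H : Type*} [TopologicalSpace H] {I : ModelWithCorners ℝ E H}
  {G : Type*} [TopologicalSpace G] [ChartedSpace H G] [Group G] [LieGroup I ∞ G]

theorem isInvertible_mfderiv_mul_right (a x : G) :
    (mfderiv I I (fun y ↦ y * a) x).IsInvertible := by
  have A : mfderiv I I ((fun y ↦ y * a⁻¹) ∘ fun y ↦ y * a) x = ContinuousLinearMap.id ℝ _ := by
    have : (fun y ↦ y * a⁻¹) ∘ (fun y ↦ y * a) = id := by ext y; simp
    rw [this, mfderiv_id]
  have A' : mfderiv I I ((fun y ↦ y * a) ∘ fun y ↦ y * a⁻¹) (x * a)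
      = ContinuousLinearMap.id ℝ _ := by
    have : (fun y ↦ y * a) ∘ (fun y ↦ y * a⁻¹) = id := by ext y; simp
    rw [this, mfderiv_id]
  rw [mfderiv_comp (I' := I) _ (mdifferentiableAt_mul_right _ _)
    (mdifferentiableAt_mul_right _ _)] at A
  rw [mfderiv_comp (I' := I) _ (mdifferentiableAt_mul_right _ _)
    (mdifferentiableAt_mul_right _ _), mul_inv_cancel_right x a] at A'
  exact ContinuousLinearMap.IsInvertible.of_inverse A' A

theorem isInvertible_mfderiv_mul_left (a x : G) :
    (mfderiv I I (fun y ↦ a * y) x).IsInvertible := by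
  have A : mfderiv I I ((fun y ↦ a⁻¹ * y) ∘ fun y ↦ a * y) x = ContinuousLinearMap.id ℝ _ := by
    have : (fun y ↦ a⁻¹ * y) ∘ (fun y ↦ a * y) = id := by ext y; simp
    rw [this, mfderiv_id]
  have A' : mfderiv I I ((fun y ↦ a * y) ∘ fun y ↦ a⁻¹ * y) (a * x)
      = ContinuousLinearMap.id ℝ _ := by
    have : (fun y ↦ a * y) ∘ (fun y ↦ a⁻¹ * y) = id := by ext y; simp
    rw [this, mfderiv_id]
  rw [mfderiv_comp (I' := I) _ (mdifferentiableAt_mul_left _ _)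
    (mdifferentiableAt_mul_left _ _)] at A
  rw [mfderiv_comp (I' := I) _ (mdifferentiableAt_mul_left _ _)
    (mdifferentiableAt_mul_left _ _), inv_mul_cancel_left a x] at A'
  exact ContinuousLinearMap.IsInvertible.of_inverse A' A

theorem isInvertible_rightDeriv (a : G) : (rightDeriv I a).IsInvertible :=
  isInvertible_mfderiv_mul_right a 1

theorem isInvertible_leftDeriv (a : G) : (leftDeriv I a).IsInvertible :=
  isInvertible_mfderiv_mul_left a 1

variable (I) in
/-- The adjoint action of `a` on the tangent space at `1`. -/
def adjointMap (a : G) : TangentSpace I (1 : G) →L[ℝ] TangentSpace I (1 : G) :=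
  (rightDeriv I a).inverse ∘L leftDeriv I a

variable (I) in
/-- The inverse of the adjoint action of `a` on the tangent space at `1`. -/
def adjointInv (a : G) : TangentSpace I (1 : G) →L[ℝ] TangentSpace I (1 : G) :=
  (leftDeriv I a).inverse ∘L rightDeriv I a

theorem rightDeriv_adjointMap (a : G) (v : TangentSpace I (1 : G)) :
    rightDeriv I a (adjointMap I a v) = leftDeriv I a v := by
  obtain ⟨e, he⟩ := isInvertible_rightDeriv (I := I) a
  simp [adjointMap, ← he]

theorem leftDeriv_adjointInv (a : G) (v : TangentSpace I (1 : G)) :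
    leftDeriv I a (adjointInv I a v) = rightDeriv I a v := by
  obtain ⟨e, he⟩ := isInvertible_leftDeriv (I := I) a
  simp [adjointInv, ← he]

theorem adjointMap_adjointInv (a : G) (v : TangentSpace I (1 : G)) :
    adjointMap I a (adjointInv I a v) = v := by
  obtain ⟨e, he⟩ := isInvertible_rightDeriv (I := I) a
  have h := rightDeriv_adjointMap a (adjointInv I a v)
  rw [leftDeriv_adjointInv, ← he] at h
  exact e.injective h

theorem isInvertible_chartDeriv {a : G} (ha : a ∈ (extChartAt I (1 : G)).source) :
    (chartDeriv I a).IsInvertible := isInvertible_mfderiv_extChartAt ha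

variable [I.Boundaryless]

/-- The adjoint action, computed in the chart. -/
theorem adjointMap_eq {a : G} (ha : a ∈ (extChartAt I (1 : G)).source) :
    adjointMap I a = (chartDeriv I a ∘L rightDeriv I a).inverse
      ∘L (chartDeriv I a ∘L leftDeriv I a) := by
  obtain ⟨e, he⟩ := isInvertible_chartDeriv (I := I) ha
  rw [← he, ContinuousLinearMap.inverse_equiv_comp]
  ext v
  simp [adjointMap]

theorem adjointInv_eq {a : G} (ha : a ∈ (extChartAt I (1 : G)).source) :
    adjointInv I a = (chartDeriv I a ∘L leftDeriv I a).inverse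
      ∘L (chartDeriv I a ∘L rightDeriv I a) := by
  obtain ⟨e, he⟩ := isInvertible_chartDeriv (I := I) ha
  rw [← he, ContinuousLinearMap.inverse_equiv_comp]
  ext v
  simp [adjointInv]

theorem hasDerivAt_fderiv_chartMul_inr {c : ℝ → E} {ξ : E} {t : ℝ} (hc : HasDerivAt c ξ t)
    (h0 : c t = extChartAt I (1 : G) 1) :
    HasDerivAt (fun s ↦ fderiv ℝ (chartMul I G) (c s, extChartAt I (1 : G) 1)
        ∘L ContinuousLinearMap.inr ℝ E E)
      (chartMulDeriv₂ I G (ξ, 0) ∘L ContinuousLinearMap.inr ℝ E E) t := by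
  have h1 : HasDerivAt (fun s ↦ (c s, extChartAt I (1 : G) 1)) (ξ, (0 : E)) t :=
    hc.prodMk (hasDerivAt_const _ _)
  have h2 := HasFDerivAt.comp_hasDerivAt_of_eq t
    (hasFDerivAt_fderiv_chartMul (I := I) (G := G)) h1 (by rw [h0])
  exact (h2.clm_comp (hasDerivAt_const t (ContinuousLinearMap.inr ℝ E E))).congr_deriv (by simp)

theorem hasDerivAt_fderiv_chartMul_inl {c : ℝ → E} {ξ : E} {t : ℝ} (hc : HasDerivAt c ξ t)
    (h0 : c t = extChartAt I (1 : G) 1) :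
    HasDerivAt (fun s ↦ fderiv ℝ (chartMul I G) (extChartAt I (1 : G) 1, c s)
        ∘L ContinuousLinearMap.inl ℝ E E)
      (chartMulDeriv₂ I G (0, ξ) ∘L ContinuousLinearMap.inl ℝ E E) t := by
  have h1 : HasDerivAt (fun s ↦ (extChartAt I (1 : G) 1, c s)) ((0 : E), ξ) t :=
    (hasDerivAt_const _ _).prodMk hc
  have h2 := HasFDerivAt.comp_hasDerivAt_of_eq t
    (hasFDerivAt_fderiv_chartMul (I := I) (G := G)) h1 (by rw [h0])
  exact (h2.clm_comp (hasDerivAt_const t (ContinuousLinearMap.inl ℝ E E))).congr_deriv (by simp)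

variable [CompleteSpace E] [FiniteDimensional ℝ E]

section Curve

variable {γ : ℝ → G} {ξ : TangentSpace I (1 : G)}

/-- The curve in the chart has the same velocity at the identity, since the chart at `1` has the
identity as its derivative there. -/
theorem hasDerivAt_extChartAt_comp
    (hγ : HasMFDerivAt 𝓘(ℝ, ℝ) I γ 0 ((1 : ℝ →L[ℝ] ℝ).smulRight (mulInvariantVectorField ξ (γ 0))))
    (h0 : γ 0 = 1) :
    HasDerivAt (fun t ↦ extChartAt I (1 : G) (γ t)) (ξ : E) 0 := by
  have h1 : ∀ y : G, y = 1 → HasMFDerivAt I 𝓘(ℝ, E) (extChartAt I (1 : G)) y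
      (ContinuousLinearMap.id ℝ E) := by
    rintro _ rfl
    have h := (mdifferentiableAt_extChartAt (I := I) (mem_chart_source H (1 : G))).hasMFDerivAt
    rwa [mfderiv_extChartAt_self] at h
  have h2 : ∀ y : G, y = 1 → (mulInvariantVectorField ξ y : E) = ξ := by
    rintro _ rfl
    exact mulInvariantVectorField_one ξ
  have h3 : HasFDerivAt (fun t ↦ extChartAt I (1 : G) (γ t))
      ((1 : ℝ →L[ℝ] ℝ).smulRight (mulInvariantVectorField ξ (γ 0) : E)) 0 :=
    hasMFDerivAt_iff_hasFDerivAt.1 ((h1 _ h0).comp 0 hγ)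
  have h4 : ∀ u : E, (1 : ℝ →L[ℝ] ℝ).smulRight u 1 = u := fun u ↦ by simp
  exact h3.hasDerivAt.congr_deriv ((h4 _).trans (h2 _ h0))

theorem eventually_extChartAt {c : ℝ → G} (hc : ContinuousAt c 0) (h0 : c 0 = 1) :
    ∀ᶠ t in 𝓝 0, c t ∈ (extChartAt I (1 : G)).source ∧
      DifferentiableAt ℝ (chartMul I G) (extChartAt I (1 : G) (c t), extChartAt I (1 : G) 1) ∧
      DifferentiableAt ℝ (chartMul I G) (extChartAt I (1 : G) 1, extChartAt I (1 : G) (c t)) := by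
  have h1 : ∀ᶠ t in 𝓝 0, c t ∈ (extChartAt I (1 : G)).source :=
    hc.eventually (h0 ▸ extChartAt_source_mem_nhds (I := I) (1 : G))
  have h2 : ContinuousAt (fun t ↦ extChartAt I (1 : G) (c t)) 0 :=
    ContinuousAt.comp (g := extChartAt I (1 : G)) (h0 ▸ continuousAt_extChartAt (I := I) (1 : G)) hc
  have h3 : Filter.Tendsto (fun t ↦ extChartAt I (1 : G) (c t)) (𝓝 0)
      (𝓝 (extChartAt I (1 : G) 1)) := by
    have h := h2.tendsto
    rwa [h0] at h
  filter_upwards [h1, (h3.prodMk_nhds tendsto_const_nhds).eventually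
      (eventually_differentiableAt_chartMul (I := I) (G := G)),
    (tendsto_const_nhds.prodMk_nhds h3).eventually
      (eventually_differentiableAt_chartMul (I := I) (G := G))] with t ht1 ht2 ht3
  exact ⟨ht1, ht2, ht3⟩

variable (I G) in
/-- The endomorphism `w ↦ [ξ, w]`, as a continuous operator on the model space `E`, which carries
a fixed norm (the tangent space at `1` is normed by the metric). -/
def adCLM (ξ : TangentSpace I (1 : G)) : E →L[ℝ] E :=
  LinearMap.toContinuousLinearMap (E := E) (F' := E) (lieBracketₗ I G ξ)

theorem adCLM_eq (ξ : TangentSpace I (1 : G)) :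
    adCLM I G ξ = chartMulDeriv₂ I G ((ξ : E), (0 : E)) ∘L ContinuousLinearMap.inr ℝ E E
      - chartMulDeriv₂ I G ((0 : E), (ξ : E)) ∘L ContinuousLinearMap.inl ℝ E E := by
  ext w
  exact lieBracketₗ_eq_chartMulDeriv₂ ξ w

/-- The derivative of the adjoint representation is the Lie bracket. -/
theorem hasDerivAt_adjointMap
    (hγ : HasMFDerivAt 𝓘(ℝ, ℝ) I γ 0 ((1 : ℝ →L[ℝ] ℝ).smulRight (mulInvariantVectorField ξ (γ 0))))
    (h0 : γ 0 = 1) :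
    HasDerivAt (F := E →L[ℝ] E) (fun t ↦ adjointMap I (γ t)) (adCLM I G ξ) 0 := by
  have hc : HasDerivAt (fun t ↦ extChartAt I (1 : G) (γ t)) (ξ : E) 0 :=
    hasDerivAt_extChartAt_comp hγ h0
  have hq := hasDerivAt_fderiv_chartMul_inr (I := I) (G := G) hc (by rw [h0])
  have hp := hasDerivAt_fderiv_chartMul_inl (I := I) (G := G) hc (by rw [h0])
  have h := hasDerivAt_ringInverse_mul hp hq (by rw [h0, fderiv_chartMul_comp_inl]; rfl)
    (by rw [h0, fderiv_chartMul_comp_inr]; rfl)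
  rw [adCLM_eq]
  refine h.congr_of_eventuallyEq ?_
  filter_upwards [eventually_extChartAt (I := I) hγ.continuousAt h0] with t ht
  rw [ContinuousLinearMap.ringInverse_eq_inverse, ← chartDeriv_comp_leftDeriv ht.1 ht.2.1,
    ← chartDeriv_comp_rightDeriv ht.1 ht.2.2]
  exact adjointMap_eq ht.1

theorem hasDerivAt_adjointInv
    (hγ : HasMFDerivAt 𝓘(ℝ, ℝ) I γ 0 ((1 : ℝ →L[ℝ] ℝ).smulRight (mulInvariantVectorField ξ (γ 0))))
    (h0 : γ 0 = 1) :
    HasDerivAt (F := E →L[ℝ] E) (fun t ↦ adjointInv I (γ t)) (-adCLM I G ξ) 0 := by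
  have hc : HasDerivAt (fun t ↦ extChartAt I (1 : G) (γ t)) (ξ : E) 0 :=
    hasDerivAt_extChartAt_comp hγ h0
  have hq := hasDerivAt_fderiv_chartMul_inr (I := I) (G := G) hc (by rw [h0])
  have hp := hasDerivAt_fderiv_chartMul_inl (I := I) (G := G) hc (by rw [h0])
  have h := hasDerivAt_ringInverse_mul hq hp (by rw [h0, fderiv_chartMul_comp_inr]; rfl)
    (by rw [h0, fderiv_chartMul_comp_inl]; rfl)
  rw [adCLM_eq, neg_sub]
  refine h.congr_of_eventuallyEq ?_
  filter_upwards [eventually_extChartAt (I := I) hγ.continuousAt h0] with t ht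
  rw [ContinuousLinearMap.ringInverse_eq_inverse, ← chartDeriv_comp_leftDeriv ht.1 ht.2.1,
    ← chartDeriv_comp_rightDeriv ht.1 ht.2.2]
  exact adjointInv_eq ht.1

end Curve
end Adjoint

/-! ### The tension field of right translations -/

section Tension

variable {E : Type*} [NormedAddCommGroup E] [NormedSpace ℝ E]
  {H : Type*} [TopologicalSpace H] {I : ModelWithCorners ℝ E H}
  {G : Type*} [TopologicalSpace G] [ChartedSpace H G] [Group G] [LieGroup I ∞ G]

/-- The differential of a right translation acts on left-invariant fields by the inverse of the
adjoint action. -/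
theorem mfderiv_mul_right_mulInvariantVectorField (a x : G) (w : TangentSpace I (1 : G)) :
    mfderiv I I (fun y ↦ y * a) x (mulInvariantVectorField (adjointMap I a w) x)
      = mulInvariantVectorField w (x * a) := by
  have h1 : (mfderiv I I (fun y ↦ x * y * a) 1 : E →L[ℝ] E)
      = (mfderiv I I (fun y ↦ y * a) x : E →L[ℝ] E) ∘L (leftDeriv I x : E →L[ℝ] E) := by
    refine Eq.trans (mfderiv_comp_of_eq (x := (1 : G)) (y := x) (g := fun y ↦ y * a)
      (f := fun y ↦ x * y)
      (mdifferentiableAt_mul_right (I := I) a x) (mdifferentiableAt_mul_left (I := I) x 1)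
      (mul_one x)) ?_
    have key : ∀ z, z = x → ∀ L : E →L[ℝ] E, (mfderiv I I (fun y ↦ y * a) z : E →L[ℝ] E) ∘L L
        = (mfderiv I I (fun y ↦ y * a) x : E →L[ℝ] E) ∘L L := by rintro _ rfl _; rfl
    exact key _ (mul_one x) _
  have h2 : (mfderiv I I (fun y ↦ x * (y * a)) 1 : E →L[ℝ] E)
      = (mfderiv I I (fun y ↦ x * y) a : E →L[ℝ] E) ∘L (rightDeriv I a : E →L[ℝ] E) := by
    refine Eq.trans (mfderiv_comp_of_eq (x := (1 : G)) (y := a) (g := fun y ↦ x * y)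
      (f := fun y ↦ y * a)
      (mdifferentiableAt_mul_left (I := I) x a) (mdifferentiableAt_mul_right (I := I) a 1)
      (one_mul a)) ?_
    have key : ∀ z, z = a → ∀ L : E →L[ℝ] E, (mfderiv I I (fun y ↦ x * y) z : E →L[ℝ] E) ∘L L
        = (mfderiv I I (fun y ↦ x * y) a : E →L[ℝ] E) ∘L L := by rintro _ rfl _; rfl
    exact key _ (one_mul a) _
  have h3 : (fun y ↦ x * y * a) = fun y ↦ x * (y * a) := by
    ext y; rw [mul_assoc]
  have h4 : (mfderiv I I (fun y ↦ x * y * a) 1 : E →L[ℝ] E)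
      = (mfderiv I I (fun y ↦ x * (y * a)) 1 : E →L[ℝ] E) := by rw [h3]
  have h5 := DFunLike.congr_fun (h1.symm.trans (h4.trans h2)) (adjointMap I a w : E)
  refine Eq.trans h5 ?_
  refine Eq.trans ?_ (isLeftInvariant_mulInvariantVectorField w x a)
  exact congrArg (fun u : TangentSpace I a ↦ mfderiv I I (fun y ↦ x * y) a u)
    (rightDeriv_adjointMap a w)

theorem mfderiv_mul_right_mulInvariantVectorField' (a x : G) (w : TangentSpace I (1 : G)) :
    mfderiv I I (fun y ↦ y * a) x (mulInvariantVectorField w x)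
      = mulInvariantVectorField (adjointInv I a w) (x * a) := by
  rw [← mfderiv_mul_right_mulInvariantVectorField, adjointMap_adjointInv]

theorem inverse_mfderiv_mul_right_apply (a x : G) (w : TangentSpace I (1 : G)) :
    (mfderiv I I (fun y ↦ y * a) x).inverse (mulInvariantVectorField w (x * a))
      = mulInvariantVectorField (adjointMap I a w) x := by
  rw [← mfderiv_mul_right_mulInvariantVectorField]
  exact DFunLike.congr_fun (isInvertible_mfderiv_mul_right a x).inverse_comp_self _

theorem mpullback_mul_right_mulInvariantVectorField (a : G) (w : TangentSpace I (1 : G)) :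
    mpullback I I (fun y ↦ y * a) (mulInvariantVectorField w)
      = mulInvariantVectorField (adjointMap I a w) := by
  ext x
  exact inverse_mfderiv_mul_right_apply a x w

variable [CompleteSpace E] [FiniteDimensional ℝ E]
  [RiemannianBundle (fun x : G ↦ TangentSpace I x)]
  [IsContMDiffRiemannianBundle I ∞ E (fun x : G ↦ TangentSpace I x)]

theorem mdifferentiableAt_mpullback {φ : G → G} {x : G} (hφ : ContMDiffAt I I 2 φ x)
    (hφ' : (mfderiv I I φ x).IsInvertible) {W : Π x : G, TangentSpace I x}
    (hW : MDiffAt (T% W) (φ x)) : MDiffAt (T% (mpullback I I φ W)) x :=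
  haveI : IsManifold I 2 G := IsManifold.of_le (n := ∞) (by norm_cast)
  MDifferentiableAt.mpullback_vectorField hW hφ hφ' le_rfl

/-- The second fundamental form does not depend on the choice of the extension. -/
theorem tensorialAt_secondFundamentalForm {φ : G → G} {x : G} (hφ : ContMDiffAt I I 2 φ x)
    (hφ' : (mfderiv I I φ x).IsInvertible) (v : TangentSpace I x) :
    TensorialAt I E (fun W ↦ leviCivita I G W (φ x) (mfderiv I I φ x v)
      - mfderiv I I φ x (leviCivita I G (mpullback I I φ W) x v)) (φ x) where
  smul {f W} hf hW := by
    have hφ1 : MDiffAt φ x := hφ.mdifferentiableAt (by simp)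
    have h1 : mfderiv I I φ x (mpullback I I φ W x) = W (φ x) := by
      obtain ⟨e, he⟩ := hφ'
      rw [mpullback_apply, ← he]
      simp
    rw [mpullback_smul, leviCivita_smul hf hW, leviCivita_smul (hf.comp x hφ1)
      (mdifferentiableAt_mpullback hφ hφ' hW), map_add, map_smul, map_smul, h1,
      mvfderiv_comp_apply x hf hφ1, Function.comp_apply]
    module
  add {W W'} hW hW' := by
    rw [mpullback_add, leviCivita_add hW hW', leviCivita_add
      (mdifferentiableAt_mpullback hφ hφ' hW) (mdifferentiableAt_mpullback hφ hφ' hW'), map_add]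
    abel

theorem contMDiffAt_two_mul_right (a x : G) : ContMDiffAt I I 2 (fun y ↦ y * a) x :=
  (contMDiff_mul_right (I := I) (n := ∞) (a := a)).contMDiffAt.of_le (by norm_cast)

variable (I G) in
/-- The second fundamental form `(∇dR_a)(v, v)` of the right translation by `a`, transported to the
Lie algebra. -/
def rightTranslationForm (a : G) (v : TangentSpace I (1 : G)) : TangentSpace I (1 : G) :=
  adjointMap I a (leviCivitaₗ I G (adjointInv I a v) (adjointInv I a v)) - leviCivitaₗ I G v v

/-- The second fundamental form of a right translation on a left-invariant field, computed with the
left-invariant extension of the image vector. -/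
theorem inverse_mfderiv_secondFundamentalForm (hG : IsLeftInvariantMetric I G) (a x : G)
    (v : TangentSpace I (1 : G)) :
    (mfderiv I I (fun y ↦ y * a) x).inverse (secondFundamentalForm (fun y ↦ y * a) x
        (mulInvariantVectorField v x) (mulInvariantVectorField v x))
      = mulInvariantVectorField (rightTranslationForm I G a v) x := by
  have h1 := (tensorialAt_secondFundamentalForm (contMDiffAt_two_mul_right a x)
    (isInvertible_mfderiv_mul_right a x) (mulInvariantVectorField v x)).pointwise
    (σ := extend E (mfderiv I I (fun y ↦ y * a) x (mulInvariantVectorField v x)))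
    (σ' := mulInvariantVectorField (adjointInv I a v))
    (mdifferentiableAt_extend ..) (mdifferentiableAt_mulInv _ _)
    (by rw [extend_apply_self, mfderiv_mul_right_mulInvariantVectorField'])
  have h2 : (mfderiv I I (fun y ↦ y * a) x).inverse
      (mfderiv I I (fun y ↦ y * a) x (mulInvariantVectorField (leviCivitaₗ I G v v) x))
      = mulInvariantVectorField (leviCivitaₗ I G v v) x :=
    DFunLike.congr_fun (isInvertible_mfderiv_mul_right a x).inverse_comp_self _
  rw [secondFundamentalForm, h1, mpullback_mul_right_mulInvariantVectorField,
    adjointMap_adjointInv, mfderiv_mul_right_mulInvariantVectorField',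
    leviCivita_mulInvariantVectorField hG, leviCivita_mulInvariantVectorField hG, map_sub, h2,
    inverse_mfderiv_mul_right_apply, ← leftTranslate_apply hG, ← leftTranslate_apply hG, ← map_sub]
  rfl

/-- The tension field of a right translation, transported to the Lie algebra. -/
theorem inverse_mfderiv_tensionField (hG : IsLeftInvariantMetric I G) (a x : G) :
    (mfderiv I I (fun y ↦ y * a) x).inverse (tensionField (I := I) (fun y ↦ y * a) x)
      = mulInvariantVectorField (∑ i, rightTranslationForm I G a (leftFrame I hG x i)) x := by
  rw [tensionField, map_sum, ← leftTranslate_apply hG, map_sum]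
  refine Finset.sum_congr rfl fun i _ ↦ ?_
  rw [leftTranslate_apply, ← inverse_mfderiv_secondFundamentalForm hG,
    ← leftTranslate_apply hG, leftFrame, OrthonormalBasis.map_apply,
    LinearIsometryEquiv.apply_symm_apply]

/-- The tension field at `x` only depends on the germ of the map at `x`. -/
theorem tensionField_congr {φ ψ : G → G} {x : G} (h : φ =ᶠ[𝓝 x] ψ) (hψ : ContMDiffAt I I 2 ψ x)
    (hψ' : (mfderiv I I ψ x).IsInvertible) :
    (mfderiv I I φ x).inverse (tensionField (I := I) φ x)
      = (mfderiv I I ψ x).inverse (tensionField (I := I) ψ x) := by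
  -- The tangent spaces at `φ x` and `ψ x` are both the model space, so that vectors at the two
  -- points are compared there.
  have h0 : φ x = ψ x := h.eq_of_nhds
  have h1 : (mfderiv I I φ x : E →L[ℝ] E) = mfderiv I I ψ x := h.mfderiv_eq
  have h2 : ∀ u : E, mpullback I I φ (extend E (B := G) (E := TangentSpace I) (x := φ x) u)
      =ᶠ[𝓝 x] mpullback I I ψ (extend E (B := G) (E := TangentSpace I) (x := ψ x) u) := by
    intro u
    filter_upwards [h.eventuallyEq_nhds] with y hy
    have hA : (mfderiv I I φ y : E →L[ℝ] E) = mfderiv I I ψ y := hy.mfderiv_eq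
    have key : ∀ (p q p' q' : G), p = q → p' = q' → ∀ A B : E →L[ℝ] E, A = B →
        A.inverse (extend E (B := G) (E := TangentSpace I) (x := p) u p')
        = B.inverse (extend E (B := G) (E := TangentSpace I) (x := q) u q') := by
      rintro p _ p' _ rfl rfl A _ rfl; rfl
    exact key _ _ _ _ h0 hy.eq_of_nhds _ _ hA
  have h3 : ∀ v w : TangentSpace I x, (secondFundamentalForm φ x v w : E)
      = secondFundamentalForm ψ x v w := by
    intro v w
    have key : ∀ (p q : G), p = q → ∀ A B : E →L[ℝ] E, A = B →
        (leviCivita I G (extend E (B := G) (E := TangentSpace I) (x := p) (A w)) p (A v) : E)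
        = leviCivita I G (extend E (B := G) (E := TangentSpace I) (x := q) (B w)) q (B v) := by
      rintro p _ rfl A _ rfl; rfl
    have h4 : leviCivita I G (mpullback I I φ (extend E (mfderiv I I φ x w))) x
        = leviCivita I G (mpullback I I ψ (extend E (mfderiv I I ψ x w))) x := by
      refine leviCivita_congr (mdifferentiableAt_mpullback hψ hψ' (mdifferentiableAt_extend ..)) ?_
      have h5 : (mfderiv I I φ x w : E) = mfderiv I I ψ x w := DFunLike.congr_fun h1 w
      have key' : ∀ a b : E, a = b →
        mpullback I I φ (extend E (B := G) (E := TangentSpace I) (x := φ x) a) =ᶠ[𝓝 x]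
         mpullback I I ψ (extend E (B := G) (E := TangentSpace I) (x := ψ x) b) := by
        rintro a _ rfl; exact h2 a
      exact key' _ _ h5
    have h6 := key _ _ h0 _ _ h1
    have key2 : ∀ (A B : E →L[ℝ] E) (a b c d : E), A = B → a = b → c = d → a - A c = b - B d := by
      rintro A _ a _ c _ rfl rfl rfl; rfl
    exact key2 _ _ _ _ _ _ h1 h6 (DFunLike.congr_fun h4 v)
  have h7 : (tensionField (I := I) φ x : E) = tensionField (I := I) ψ x :=
    Finset.sum_congr (M := E) rfl fun i _ ↦ h3 _ _
  have key3 : ∀ (A B : E →L[ℝ] E) (a b : E), A = B → a = b → A.inverse a = B.inverse b := by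
    rintro A _ a _ rfl rfl; rfl
  exact key3 _ _ _ _ h1 h7

end Tension

/-! ### The flow of a left-invariant vector field -/

section Flow

/-- The derivative of the transport of a bilinear map along a curve of linear automorphisms is its
Lie derivative. -/
theorem hasDerivAt_transport_bilin {E : Type*} [NormedAddCommGroup E] [NormedSpace ℝ E]
    {A A' : ℝ → E →L[ℝ] E} {D : E →L[ℝ] E} {B : E →L[ℝ] E →L[ℝ] E} {t : ℝ}
    (hA : HasDerivAt A D t) (hA' : HasDerivAt A' (-D) t) (h : A t = ContinuousLinearMap.id ℝ E)
    (h' : A' t = ContinuousLinearMap.id ℝ E) (v : E) :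
    HasDerivAt (fun s ↦ A s (B (A' s v) (A' s v)) - B v v) (D (B v v) - B (D v) v - B v (D v))
      t := by
  have h1 : HasDerivAt (fun s ↦ A' s v) (-D v) t :=
    (hA'.clm_apply (hasDerivAt_const t v)).congr_deriv (by simp)
  have h2 := (B.hasFDerivAt.comp_hasDerivAt t h1).clm_apply h1
  refine ((hA.clm_apply h2).sub_const (B v v)).congr_deriv ?_
  simp only [Function.comp_apply, h, h', ContinuousLinearMap.id_apply, map_neg,
    _root_.neg_apply]
  abel

variable {E : Type*} [NormedAddCommGroup E] [NormedSpace ℝ E]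
  {H : Type*} [TopologicalSpace H] {I : ModelWithCorners ℝ E H}
  {G : Type*} [TopologicalSpace G] [ChartedSpace H G] [Group G] [LieGroup I ∞ G]
  [CompleteSpace E] [FiniteDimensional ℝ E]

theorem leftDeriv_one (v : TangentSpace I (1 : G)) : leftDeriv I (1 : G) v = v :=
  mulInvariantVectorField_one v

theorem rightDeriv_one (v : TangentSpace I (1 : G)) : rightDeriv I (1 : G) v = v := by
  have h : (fun y : G ↦ y * 1) = id := by ext y; simp
  have h1 : (mfderiv I I (fun y : G ↦ y * 1) 1 : E →L[ℝ] E) = ContinuousLinearMap.id ℝ E := by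
    rw [h]
    exact mfderiv_id
  exact DFunLike.congr_fun h1 v

theorem adjointMap_one : adjointMap I (1 : G) = ContinuousLinearMap.id ℝ _ := by
  ext v
  have h := rightDeriv_adjointMap (1 : G) v
  rwa [leftDeriv_one, rightDeriv_one] at h

theorem adjointInv_one : adjointInv I (1 : G) = ContinuousLinearMap.id ℝ _ := by
  ext v
  have h := leftDeriv_adjointInv (1 : G) v
  rwa [leftDeriv_one, rightDeriv_one] at h

/-- Left translates of integral curves of left-invariant fields are integral curves. -/
theorem isMIntegralCurveOn_mul_left {γ : ℝ → G} {ξ : TangentSpace I (1 : G)} {s : Set ℝ}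
    (hγ : IsMIntegralCurveOn γ (mulInvariantVectorField ξ) s) (y : G) :
    IsMIntegralCurveOn (fun t ↦ y * γ t) (mulInvariantVectorField ξ : Π x : G, TangentSpace I x)
      s := by
  intro t ht
  have h := (mdifferentiableAt_mul_left (I := I) y (γ t)).hasMFDerivAt.comp_hasMFDerivWithinAt t
    (hγ t ht)
  have e : ((mfderiv I I (fun z ↦ y * z) (γ t) : E →L[ℝ] E) ∘L
      (1 : ℝ →L[ℝ] ℝ).smulRight (mulInvariantVectorField ξ (γ t) : E))
      = (1 : ℝ →L[ℝ] ℝ).smulRight (mulInvariantVectorField ξ (y * γ t) : E) := by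
    ext
    have h1 : (mfderiv I I (fun z ↦ y * z) (γ t) : E →L[ℝ] E) (mulInvariantVectorField ξ (γ t) : E)
        = (mulInvariantVectorField ξ (y * γ t) : E) :=
      isLeftInvariant_mulInvariantVectorField ξ y (γ t)
    simpa using h1
  exact (congrArg (fun L : ℝ →L[ℝ] E ↦ HasMFDerivWithinAt 𝓘(ℝ, ℝ) I (fun t ↦ y * γ t) s t L) e).mp h

variable [I.Boundaryless]

/-- The local one-parameter subgroup with a given initial velocity. -/
theorem exists_isMIntegralCurveOn_mulInvariantVectorField (ξ : TangentSpace I (1 : G)) :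
    ∃ (γ : ℝ → G) (ε : ℝ), 0 < ε ∧ γ 0 = 1 ∧
      IsMIntegralCurveOn γ (mulInvariantVectorField ξ) (Set.Ioo (-ε) ε) := by
  have : IsManifold I 1 G := IsManifold.of_le (n := ∞) (by norm_cast)
  obtain ⟨γ, h0, hγ⟩ := exists_isMIntegralCurveAt_of_contMDiffAt_boundaryless (0 : ℝ)
    (((contMDiff_two_mulInvariantVectorField ξ).of_le one_le_two).contMDiffAt (x := (1 : G)))
  obtain ⟨ε, hε, h⟩ := isMIntegralCurveAt_iff'.1 hγ
  refine ⟨γ, ε, hε, h0, ?_⟩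
  rwa [Real.ball_eq_Ioo, zero_sub, zero_add] at h

/-- A local flow of a left-invariant field consists of right translations by the local
one-parameter subgroup. -/
theorem IsLocalFlow.eventuallyEq_mul_right [T2Space G] {γ : ℝ → G} {ξ : TangentSpace I (1 : G)}
    {ε : ℝ} (hε : 0 < ε) (h0 : γ 0 = 1)
    (hγ : IsMIntegralCurveOn γ (mulInvariantVectorField ξ) (Set.Ioo (-ε) ε))
    {Φ : ℝ → G → G} {U : Set G} {δ : ℝ} (hδ : 0 < δ) {x : G} (hU : U ∈ 𝓝 x)
    (hΦ : IsLocalFlow (mulInvariantVectorField ξ : Π x : G, TangentSpace I x) Φ U δ) :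
    ∀ᶠ t in 𝓝 0, Φ t =ᶠ[𝓝 x] fun y ↦ y * γ t := by
  have : IsManifold I 1 G := IsManifold.of_le (n := ∞) (by norm_cast)
  have hmin : 0 < min ε δ := lt_min hε hδ
  filter_upwards [Ioo_mem_nhds (neg_lt_zero.2 hmin) hmin] with t ht
  filter_upwards [hU] with y hy
  refine isMIntegralCurveOn_Ioo_eqOn_of_contMDiff_boundaryless (I := I) (t₀ := 0)
    (γ := fun t ↦ Φ t y) (γ' := fun t ↦ y * γ t)
    (a := -min ε δ) (b := min ε δ) ⟨neg_lt_zero.2 hmin, hmin⟩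
    ((contMDiff_two_mulInvariantVectorField ξ).of_le one_le_two)
    ((hΦ y hy).2.mono (Set.Ioo_subset_Ioo (neg_le_neg (min_le_right _ _)) (min_le_right _ _)))
    ((isMIntegralCurveOn_mul_left hγ y).mono
      (Set.Ioo_subset_Ioo (neg_le_neg (min_le_left _ _)) (min_le_left _ _))) ?_ ht
  rw [(hΦ y hy).1, h0, mul_one]

variable [RiemannianBundle (fun x : G ↦ TangentSpace I x)]
  [IsContMDiffRiemannianBundle I ∞ E (fun x : G ↦ TangentSpace I x)]

/-- The derivative of `(∇dR_a)(v, v)` along the one-parameter subgroup is `(L_ξ ∇)(v, v)`. -/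
theorem hasDerivAt_rightTranslationForm {γ : ℝ → G} {ξ : TangentSpace I (1 : G)}
    (hγ : HasMFDerivAt 𝓘(ℝ, ℝ) I γ 0 ((1 : ℝ →L[ℝ] ℝ).smulRight (mulInvariantVectorField ξ (γ 0))))
    (h0 : γ 0 = 1) (v : TangentSpace I (1 : G)) :
    HasDerivAt (F := E) (fun t ↦ rightTranslationForm I G (γ t) v)
      (lieDerivLeviCivitaₗ I G ξ v v) 0 := by
  -- The connection, as a continuous bilinear map on the model space.
  let B : E →L[ℝ] E →L[ℝ] E := LinearMap.toContinuousLinearMap (E := E)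
    ((LinearMap.toContinuousLinearMap (𝕜 := ℝ) (E := E) (F' := E)).toLinearMap ∘ₗ
      (leviCivitaₗ I G : E →ₗ[ℝ] E →ₗ[ℝ] E))
  exact hasDerivAt_transport_bilin (B := B) (hasDerivAt_adjointMap hγ h0)
    (hasDerivAt_adjointInv hγ h0) (by rw [h0]; exact adjointMap_one)
    (by rw [h0]; exact adjointInv_one) v

/-- The derivative at time zero of the tension field of the flow of a left-invariant field. -/
theorem hasDerivAt_tensionField [T2Space G] (hG : IsLeftInvariantMetric I G) {γ : ℝ → G}
    {ξ : TangentSpace I (1 : G)} {ε : ℝ} (hε : 0 < ε) (h0 : γ 0 = 1)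
    (hγ : IsMIntegralCurveOn γ (mulInvariantVectorField ξ) (Set.Ioo (-ε) ε))
    {Φ : ℝ → G → G} {U : Set G} {δ : ℝ} (hδ : 0 < δ) {x : G} (hU : U ∈ 𝓝 x)
    (hΦ : IsLocalFlow (mulInvariantVectorField ξ : Π x : G, TangentSpace I x) Φ U δ) :
    HasDerivAt (fun t ↦ (mfderiv I I (Φ t) x).inverse (tensionField (I := I) (Φ t) x))
      (traceLieDerivConnection (mulInvariantVectorField ξ) x) (0 : ℝ) := by
  have hγ' := (hγ 0 ⟨neg_lt_zero.2 hε, hε⟩).hasMFDerivAt (Ioo_mem_nhds (neg_lt_zero.2 hε) hε)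
  have h1 : HasDerivAt (F := E) (fun t ↦ ∑ i, (rightTranslationForm I G (γ t) (leftFrame I hG x i)))
      (∑ i, lieDerivLeviCivitaₗ I G ξ (leftFrame I hG x i) (leftFrame I hG x i)) 0 :=
    HasDerivAt.fun_sum (F := E) fun i _ ↦ hasDerivAt_rightTranslationForm hγ' h0 _
  have h2 : HasDerivAt (F := E) (fun t ↦ (leftDeriv I x : E →L[ℝ] E)
      (∑ i, (rightTranslationForm I G (γ t) (leftFrame I hG x i))))
      ((leftDeriv I x : E →L[ℝ] E)
        (∑ i, lieDerivLeviCivitaₗ I G ξ (leftFrame I hG x i) (leftFrame I hG x i))) 0 :=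
    ContinuousLinearMap.hasFDerivAt (leftDeriv I x : E →L[ℝ] E) |>.comp_hasDerivAt (0 : ℝ) h1
  rw [traceLieDerivConnection_eq hG]
  have h3 : (fun t ↦ (mfderiv I I (Φ t) x).inverse (tensionField (I := I) (Φ t) x)) =ᶠ[𝓝 0]
      fun t ↦ mulInvariantVectorField (∑ i, rightTranslationForm I G (γ t) (leftFrame I hG x i))
        x := by
    filter_upwards [hΦ.eventuallyEq_mul_right hε h0 hγ hδ hU] with t ht
    rw [tensionField_congr ht (contMDiffAt_two_mul_right _ _) (isInvertible_mfderiv_mul_right _ _),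
      inverse_mfderiv_tensionField hG]
  exact HasDerivAt.congr_of_eventuallyEq (F := TangentSpace I x) h2 h3

/-- The local flow in the definition of one-harmonicity exists, and the condition does not depend
on its choice. -/
theorem isOneHarmonicKilling_iff [T2Space G] (hG : IsLeftInvariantMetric I G)
    (ξ : TangentSpace I (1 : G)) :
    IsOneHarmonicKilling (mulInvariantVectorField ξ : Π x : G, TangentSpace I x) ↔
      ∀ x : G, traceLieDerivConnection (mulInvariantVectorField ξ) x = 0 := by
  obtain ⟨γ, ε, hε, h0, hγ⟩ := exists_isMIntegralCurveOn_mulInvariantVectorField ξ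
  constructor
  · intro h x
    obtain ⟨Φ, U, δ, hU, hδ, hΦ, hd⟩ := h x
    exact (hasDerivAt_tensionField hG hε h0 hγ hδ hU hΦ).unique hd
  · intro h x
    have hΦ : IsLocalFlow (mulInvariantVectorField ξ : Π x : G, TangentSpace I x)
        (fun t y ↦ y * γ t) Set.univ ε :=
      fun y _ ↦ ⟨by simp only [h0, mul_one], isMIntegralCurveOn_mul_left hγ y⟩
    refine ⟨fun t y ↦ y * γ t, Set.univ, ε, Filter.univ_mem, hε, hΦ, ?_⟩
    rw [← h x]
    exact hasDerivAt_tensionField hG hε h0 hγ hε Filter.univ_mem hΦ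

theorem isKilling_iff_lieBracketₗ_eq_zero [LieRing.IsNilpotent (GroupLieAlgebra I G)]
    (hG : IsLeftInvariantMetric I G) (ξ : TangentSpace I (1 : G)) :
    IsKilling (mulInvariantVectorField ξ : Π x : G, TangentSpace I x) ↔ lieBracketₗ I G ξ = 0 := by
  rw [isKilling_mulInvariantVectorField_iff hG]
  refine ⟨eq_zero_of_isNilpotent_of_skew (isNilpotent_lieBracketₗ ξ), fun h v w ↦ ?_⟩
  simp [h]

theorem traceLieDerivConnection_eq_zero_iff [LieRing.IsNilpotent (GroupLieAlgebra I G)]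
    (hG : IsLeftInvariantMetric I G) (ξ : TangentSpace I (1 : G)) :
    (∀ x : G, traceLieDerivConnection (mulInvariantVectorField ξ) x = 0) ↔
      lieBracketₗ I G ξ = 0 := by
  constructor
  · intro h
    have h1 := h 1
    rw [traceLieDerivConnection_eq hG, ← leftTranslate_apply hG, map_eq_zero_iff _
      (leftTranslate hG 1).injective] at h1
    exact eq_zero_of_trace_lieDeriv_eq_zero (lieBracketₗ I G) (fun v w ↦ leviCivitaₗ I G v w)
      lieBracketₗ_skew (two_mul_inner_leviCivitaₗ hG) isNilpotent_lieBracketₗ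
      (leftFrame I hG 1) h1
  · intro h x
    rw [traceLieDerivConnection_eq hG, ← leftTranslate_apply hG]
    simp [lieDerivLeviCivitaₗ_apply, h]

end Flow

end OneHarmonic

end

theorem mainTheorem2 {G : Type*} [TopologicalSpace G] [T2Space G]
    [ChartedSpace (EuclideanSpace ℝ (Fin 5)) G] [Group G] [LieGroup (𝓡 5) ∞ G]
    [SimplyConnectedSpace G] [LieRing.IsNilpotent (GroupLieAlgebra (𝓡 5) G)]
    [RiemannianBundle (fun x : G ↦ TangentSpace (𝓡 5) x)]
    [IsContMDiffRiemannianBundle (𝓡 5) ∞ (EuclideanSpace ℝ (Fin 5))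
      (fun x : G ↦ TangentSpace (𝓡 5) x)]
    (hmetric : OneHarmonic.IsLeftInvariantMetric (𝓡 5) G)
    (ξ : Π x : G, TangentSpace (𝓡 5) x) (hξ : OneHarmonic.IsLeftInvariant ξ) :
    (OneHarmonic.IsOneHarmonicKilling ξ ↔ OneHarmonic.IsKilling ξ) ∧
      ((∀ x : G, OneHarmonic.traceLieDerivConnection ξ x = 0) ↔ OneHarmonic.IsKilling ξ) ∧
      (OneHarmonic.IsKilling ξ ↔ ξ 1 ∈ LieAlgebra.center ℝ (GroupLieAlgebra (𝓡 5) G)) := by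
  have hK : OneHarmonic.IsKilling ξ ↔ OneHarmonic.lieBracketₗ (𝓡 5) G (ξ 1) = 0 := by
    conv_lhs => rw [hξ.eq_mulInvariantVectorField]
    exact OneHarmonic.isKilling_iff_lieBracketₗ_eq_zero hmetric (ξ 1)
  have hT : (∀ x : G, OneHarmonic.traceLieDerivConnection ξ x = 0) ↔
      OneHarmonic.lieBracketₗ (𝓡 5) G (ξ 1) = 0 := by
    conv_lhs => rw [hξ.eq_mulInvariantVectorField]
    exact OneHarmonic.traceLieDerivConnection_eq_zero_iff hmetric (ξ 1)
  have hO : OneHarmonic.IsOneHarmonicKilling ξ ↔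
      ∀ x : G, OneHarmonic.traceLieDerivConnection ξ x = 0 := by
    have h := OneHarmonic.isOneHarmonicKilling_iff hmetric (ξ 1)
    rwa [← hξ.eq_mulInvariantVectorField] at h
  exact ⟨hO.trans (hT.trans hK.symm), hT.trans hK.symm,
    hK.trans (OneHarmonic.lieBracketₗ_eq_zero_iff (ξ 1))⟩
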